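/- **Setting.** Let $X_1,X_2,\dots$ be i.i.d. random variables on a probability space $(\Omega,\mathcal T,\mathbb P)$ with law $P$ on a measurable space $\mathcal X$, and let $\mathbb P_n(f)=\frac1n\sum_{i=1}^n f(X_i)$. Let $N\ge 0$ and, for $1\le k\le N$, let $\mathcal A^{(k)}=\{A^{(k)}_1,\dots,A^{(k)}_{m_k}\}$ be a finite measurable partition of $\mathcal X$ with $P(A^{(k)}_j)>0$ for all $j$. The raking-ratio empirical measure is defined by $\mathbb P_n^{(0)}=\mathbb P_n$ and, for $1\le k\le N$, $$\mathbb P_n^{(k)}(f)=\sum_{j=1}^{m_k}\frac{P(A_j^{(k)})}{\mathbb P_n^{(k-1)}(A_j^{(k)})}\,\mathbb P_n^{(k-1)}(f\mathbf 1_{A_j^{(k)}}),$$ where $Q(A)=Q(\mathbf 1_A)$ and a quotient with zero denominator is read as $0$. For $1\le k\le N$ and $n\ge1$ let $n_k=n_k(n)>n$ be integers and let $\mathbb P'_k[\mathcal A^{(k)}]=(\mathbb P'_k(A^{(k)}_1),\dots,\mathbb P'_k(A^{(k)}_{m_k}))$ (depending on $n$) be the random vector of frequencies (counts divided by $n_k$)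 of a multinomial experiment with $n_k$ trials and event probabilities $P(A^{(k)}_1),\dots,P(A^{(k)}_{m_k})$; these vectors need not be independent of each other or of the sample. Let $\widetilde{\mathbb P}_n^{(k)}$ be defined by the same recursion with $\mathbb P'_k(A_j^{(k)})$ in place of $P(A_j^{(k)})$, starting from $\widetilde{\mathbb P}_n^{(0)}=\mathbb P_n$. Put $n_{(N)}=\min_{1\le k\le N}n_k$ (for $N\ge1$). Let $\mathcal B=\{B_1,\dots,B_m\}$, $m\ge2$, be a measurable partition of $\mathcal X$ and $P_0$ a probability measure on $\mathcal X$ with $P_0(B_i)>0$ for all $i$. Let $$T_n=n\sum_{i=1}^m\frac{(\mathbb P_n(B_i)-P_0(B_i))^2}{P_0(B_i)},\quad T_n^{(N)}=n\sum_{i=1}^m\frac{(\mathbb P_n^{(N)}(B_i)-P_0(B_i))^2}{P_0(B_i)},\quad \widetilde T_n^{(N)}=n\sum_{i=1}^m\frac{(\widetilde{\mathbb P}_n^{(N)}(B_i)-P_0(B_i))^2}{P_0(B_i)},$$ and, for $\alpha\in(0,1)$, let $t_\alpha^{(m)}$ be the $(1-\alpha)$-quantile of the $\chi^2$ distribution with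 $m-1$ degrees of freedom. **Proposition.** (i) Suppose $(H_0)$: $P(B_i)=P_0(B_i)$ for all $i$. Then for all $\alpha\in(0,1)$ the following limits exist and satisfy $$\lim_{n\to\infty}\mathbb P(T_n^{(N)}>t_\alpha^{(m)})\le\lim_{n\to\infty}\mathbb P(T_n>t_\alpha^{(m)})=\alpha .$$ If moreover $N\ge1$ and $n\log n=o(n_{(N)})$, then the following limit exists and satisfies $$\lim_{n\to\infty}\mathbb P(\widetilde T_n^{(N)}>t_\alpha^{(m)})\le\alpha .$$ (ii) Suppose $(H_1)$: $P(B_i)\ne P_0(B_i)$ for some $i$. Then for all $\alpha\in(0,1)$, almost surely there exists $n_0$ such that for all $n>n_0$, $$\min\big(|T_n|,|T_n^{(N)}|,|\widetilde T_n^{(N)}|\big)>t_\alpha^{(m)} .$$ -/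

import Mathlib

open MeasureTheory ProbabilityTheory Filter Topology Asymptotics

noncomputable section

namespace RakingRatio

/-- A finite measurable partition of `𝒳` into the sets `A 0, …, A (m - 1)`. -/
structure IsMeasurablePartition {𝒳 : Type*} [MeasurableSpace 𝒳] {m : ℕ}
    (A : Fin m → Set 𝒳) : Prop where
  measurableSet : ∀ j, MeasurableSet (A j)
  pairwise_disjoint : Pairwise fun i j => Disjoint (A i) (A j)
  iUnion_eq : ⋃ j, A j = Set.univ

/-- The empirical measure `ℙₙ(f) = (1/n) ∑_{i ≤ n} f(xᵢ)` of the first `n` points of a sample. -/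
def empirical {𝒳 : Type*} (x : ℕ → 𝒳) (n : ℕ) (f : 𝒳 → ℝ) : ℝ :=
  (∑ i ∈ Finset.range n, f (x i)) / n

/-- The raking-ratio empirical measure after `N` steps, the `k`-th step (`k = 1, …, N`) using the
partition `A k` and the weights `p k` as (true or learned) probabilities of its sets. -/
def raked {𝒳 : Type*} {mA : ℕ → ℕ} (A : (k : ℕ) → Fin (mA k) → Set 𝒳)
    (p : (k : ℕ) → Fin (mA k) → ℝ) (x : ℕ → 𝒳) (n : ℕ) : ℕ → (𝒳 → ℝ) → ℝ
  | 0, f => empirical x n f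
  | N + 1, f =>
      ∑ j, p (N + 1) j / raked A p x n N ((A (N + 1) j).indicator 1) *
        raked A p x n N ((A (N + 1) j).indicator f)

/-- The law of one trial with outcome `j` of probability `p j`. -/
def categorical {m : ℕ} (p : Fin m → ℝ) : Measure (Fin m) :=
  ∑ j, ENNReal.ofReal (p j) • Measure.dirac j

/-- The multinomial law: the numbers of occurrences of the outcomes in `n` independent trials
with event probabilities `p`. -/
def multinomial {m : ℕ} (n : ℕ) (p : Fin m → ℝ) : Measure (Fin m → ℕ) :=
  (Measure.pi fun _ : Fin n => categorical p).map
    fun y j => (Finset.univ.filter fun i => y i = j).card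

/-- The law of the vector of observed frequencies of a multinomial experiment with `n` trials. -/
def multinomialFreq {m : ℕ} (n : ℕ) (p : Fin m → ℝ) : Measure (Fin m → ℝ) :=
  (multinomial n p).map fun c j => (c j : ℝ) / n

/-- The smallest of the sizes of the sources `1, …, N` (meaningful for `N ≥ 1`), where
`size k n` is the size of the `k`-th source when the main sample has size `n`. -/
def minSize (size : ℕ → ℕ → ℕ) (N n : ℕ) : ℕ :=
  sInf ((fun k => size k n) '' Set.Icc 1 N)

/-- The `χ²` law with `d` degrees of freedom. -/
def chiSquare (d : ℕ) : Measure ℝ :=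
  (Measure.pi fun _ : Fin d => gaussianReal 0 1).map fun z => ∑ i, z i ^ 2

/-- The quantile function of a law on `ℝ`. -/
def quantile (ν : Measure ℝ) (u : ℝ) : ℝ :=
  sInf {t : ℝ | u ≤ cdf ν t}

/-- The critical value at level `α` of the chi-square test on `m` cells, i.e. the
`1 - α` quantile of `χ²(m - 1)`. -/
def critical (m : ℕ) (α : ℝ) : ℝ :=
  quantile (chiSquare (m - 1)) (1 - α)

/-- The chi-square statistic `n ∑ᵢ (Q(Bᵢ) - P₀(Bᵢ))² / P₀(Bᵢ)` of an estimate `Q` of the law. -/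
def chiStat {𝒳 : Type*} [MeasurableSpace 𝒳] {m : ℕ} (B : Fin m → Set 𝒳) (P₀ : Measure 𝒳)
    (n : ℕ) (Q : (𝒳 → ℝ) → ℝ) : ℝ :=
  n * ∑ i, (Q ((B i).indicator 1) - P₀.real (B i)) ^ 2 / P₀.real (B i)

/-- The usual chi-square statistic `Tₙ`. -/
def stat {Ω 𝒳 : Type*} [MeasurableSpace 𝒳] {m : ℕ} (B : Fin m → Set 𝒳) (P₀ : Measure 𝒳)
    (X : ℕ → Ω → 𝒳) (n : ℕ) (ω : Ω) : ℝ :=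
  chiStat B P₀ n (empirical (fun i => X i ω) n)

/-- The statistic `Tₙ⁽ᴺ⁾`, raked with the true probabilities of the sets of `A 1, …, A N`. -/
def statTrue {Ω 𝒳 : Type*} [MeasurableSpace 𝒳] {m : ℕ} (B : Fin m → Set 𝒳) (P₀ P : Measure 𝒳)
    {mA : ℕ → ℕ} (A : (k : ℕ) → Fin (mA k) → Set 𝒳) (X : ℕ → Ω → 𝒳) (N n : ℕ) (ω : Ω) : ℝ :=
  chiStat B P₀ n (raked A (fun k j => P.real (A k j)) (fun i => X i ω) n N)

/-- The statistic `T̃ₙ⁽ᴺ⁾`, raked with learned probabilities; `learned k n ω` is the estimate of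
the probabilities of the sets of `A k` used when the main sample has size `n`. -/
def statLearned {Ω 𝒳 : Type*} [MeasurableSpace 𝒳] {m : ℕ} (B : Fin m → Set 𝒳) (P₀ : Measure 𝒳)
    {mA : ℕ → ℕ} (A : (k : ℕ) → Fin (mA k) → Set 𝒳)
    (learned : (k : ℕ) → ℕ → Ω → Fin (mA k) → ℝ) (X : ℕ → Ω → 𝒳) (N n : ℕ) (ω : Ω) : ℝ :=
  chiStat B P₀ n (raked A (fun k => learned k n ω) (fun i => X i ω) n N)

end RakingRatio

end

/-!
To first order, raking with weights `P(A j) + o(1/√n)` changes the fluctuation `√n (ℙₙ(f) - P(f))`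
into that of `f` minus its conditional expectation given the cells `A j`. Hence the raked
fluctuations of the normalized indicators of the cells `B i` have a centered Gaussian limit, whose
covariance is that of the successively centered indicators. Conditional centering contracts the
variance, so that this covariance is dominated, as a quadratic form, by the one obtained without
raking; therefore so are the tails of the squared norm of the limit, which without raking follows
the `χ²(m - 1)` law.

The learned frequencies differ from `P(A j)` by `o(1/√n)` in probability as soon as `n = o(n_k)`,
and they converge almost surely as soon as `log n = o(n_k)`, both by Hoeffding's inequality. Under
the alternative the law of large numbers makes each statistic grow linearly in `n`.
-/

noncomputable section

namespace RakingRatio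

section InProbability

variable {ι Ω E : Type*} [MeasurableSpace Ω] {μ : Measure Ω} {l : Filter ι}

/-- The filter of the sets of pairs `(i, ω)` whose section at `i` has a complement of measure
tending to `0` along `l`. Convergence in probability to a constant is `Tendsto` along it, so that
the calculus of limits applies verbatim. -/
def inProbability (μ : Measure Ω) (l : Filter ι) : Filter (ι × Ω) where
  sets := {s | Tendsto (fun i => μ {ω | (i, ω) ∉ s}) l (𝓝 0)}
  univ_sets := by simpa using tendsto_const_nhds
  sets_of_superset {s t} hs hst :=
    tendsto_of_tendsto_of_tendsto_of_le_of_le tendsto_const_nhds hs (fun _ => zero_le)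
      fun _ => measure_mono fun _ hω h => hω (hst h)
  inter_sets {s t} hs ht := by
    have hadd := hs.add ht
    rw [add_zero] at hadd
    refine tendsto_of_tendsto_of_tendsto_of_le_of_le tendsto_const_nhds hadd
      (fun _ => zero_le) fun i => (measure_mono fun ω hω => ?_).trans (measure_union_le _ _)
    exact not_and_or.1 hω

lemma mem_inProbability {s : Set (ι × Ω)} :
    s ∈ inProbability μ l ↔ Tendsto (fun i => μ {ω | (i, ω) ∉ s}) l (𝓝 0) :=
  Iff.rfl

lemma tendsto_fst_inProbability : Tendsto Prod.fst (inProbability μ l) l := fun s hs => by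
  refine mem_inProbability.2 (tendsto_const_nhds.congr' ?_)
  filter_upwards [hs] with i hi
  simp [hi]

theorem tendstoInMeasure_const_iff [PseudoEMetricSpace E] {Y : ι → Ω → E} {a : E} :
    TendstoInMeasure μ Y l (fun _ => a) ↔
      Tendsto (fun z : ι × Ω => Y z.1 z.2) (inProbability μ l) (𝓝 a) := by
  simp [Metric.nhds_basis_eball.tendsto_right_iff, Filter.Eventually, mem_inProbability,
    TendstoInMeasure]

variable {Ω' : Type*} [MeasurableSpace Ω'] {ν : Measure Ω'} [IsProbabilityMeasure μ]
  [IsProbabilityMeasure ν] [NormedAddCommGroup E] [MeasurableSpace E] [BorelSpace E]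
  [CompleteSpace E] [SecondCountableTopology E] {Y : ι → Ω → E} {Z : Ω' → E}

theorem exists_eventually_measure_le_norm_lt (hY : TendstoInDistribution Y l Z (fun _ => μ) ν)
    {ε : ENNReal} (hε : 0 < ε) : ∃ K : ℝ, 0 < K ∧ ∀ᶠ i in l, μ {ω | K ≤ ‖Y i ω‖} < ε := by
  have htight := tendsto_measure_norm_gt_of_isTightMeasureSet
    (isTightMeasureSet_singleton (μ := ν.map Z))
  simp only [Set.mem_singleton_iff, iSup_iSup_eq_left] at htight
  obtain ⟨r, hr, hr0⟩ := ((htight.eventually_lt_const hε).and (eventually_gt_atTop 0)).exists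
  have hclosed : IsClosed {x : E | r + 1 ≤ ‖x‖} := isClosed_le continuous_const continuous_norm
  refine ⟨r + 1, by positivity, ?_⟩
  have hlimsup := (ProbabilityMeasure.limsup_measure_closed_le_of_tendsto hY.tendsto
    hclosed).trans_lt ((measure_mono fun x hx => (lt_add_one r).trans_le hx).trans_lt hr)
  filter_upwards [eventually_lt_of_limsup_lt hlimsup] with i hi
  rwa [ProbabilityMeasure.coe_mk, Measure.map_apply_of_aemeasurable (hY.forall_aemeasurable i)
    hclosed.measurableSet] at hi

-- A sequence converging in distribution is bounded in probability.
theorem tendsto_smul_zero_of_tendstoInDistribution [NormedSpace ℝ E]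
    (hY : TendstoInDistribution Y l Z (fun _ => μ) ν) {c : ι × Ω → ℝ}
    (hc : Tendsto c (inProbability μ l) (𝓝 0)) :
    Tendsto (fun z => c z • Y z.1 z.2) (inProbability μ l) (𝓝 0) := by
  refine Metric.tendsto_nhds.2 fun δ hδ => mem_inProbability.2 ?_
  refine ENNReal.tendsto_nhds_zero.2 fun ε hε => ?_
  have hε2 : 0 < ε / 2 := ENNReal.half_pos hε.ne'
  obtain ⟨K, hK, hYK⟩ := exists_eventually_measure_le_norm_lt hY hε2
  have hcK := mem_inProbability.1 (Metric.tendsto_nhds.1 hc (δ / K) (by positivity))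
  filter_upwards [hYK, hcK.eventually_lt_const hε2] with i hYi hci
  refine (measure_mono fun ω hω => ?_).trans <| (measure_union_le _ _).trans <|
    (add_le_add hYi.le hci.le).trans_eq (ENNReal.add_halves ε)
  by_contra hcon
  simp only [Set.mem_union, Set.mem_ofPred_eq, not_or, not_le, not_not, dist_zero_right] at hcon hω
  refine hω ?_
  calc ‖c (i, ω) • Y i ω‖ = ‖c (i, ω)‖ * ‖Y i ω‖ := norm_smul _ _
    _ < δ / K * K := mul_lt_mul'' hcon.2 hcon.1 (norm_nonneg _) (norm_nonneg _)
    _ = δ := div_mul_cancel₀ δ hK.ne'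

end InProbability

section BorelCantelli

theorem ae_tendsto_of_summable_measureReal_le_dist {Ω E : Type*} [MeasurableSpace Ω]
    {μ : Measure Ω} [IsFiniteMeasure μ] [PseudoMetricSpace E] {Y : ℕ → Ω → E} {a : E}
    (h : ∀ ε : ℝ, 0 < ε → Summable fun n => μ.real {ω | ε ≤ dist (Y n ω) a}) :
    ∀ᵐ ω ∂μ, Tendsto (fun n => Y n ω) atTop (𝓝 a) := by
  have hfar (k : ℕ) : ∀ᵐ ω ∂μ, ∀ᶠ n in atTop, dist (Y n ω) a < 1 / ((k : ℝ) + 1) := by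
    have hsum : ∑' n, μ {ω | 1 / ((k : ℝ) + 1) ≤ dist (Y n ω) a} ≠ ⊤ := by
      simp_rw [← ofReal_measureReal (measure_ne_top μ _)]
      exact (h _ Nat.one_div_pos_of_nat).tsum_ofReal_ne_top
    simpa only [Set.mem_ofPred_eq, not_le] using ae_eventually_notMem hsum
  filter_upwards [ae_all_iff.2 hfar] with ω hω
  refine Metric.tendsto_nhds.2 fun ε hε => ?_
  obtain ⟨k, hk⟩ := exists_nat_one_div_lt hε
  exact (hω k).mono fun n hn => hn.trans hk

end BorelCantelli

section GaussianNullSets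

theorem absolutelyContinuous_pi {d : ℕ} {α : Fin d → Type*} [∀ i, MeasurableSpace (α i)]
    {γ ν : ∀ i, Measure (α i)} [∀ i, SigmaFinite (γ i)] [∀ i, SigmaFinite (ν i)]
    (h : ∀ i, γ i ≪ ν i) : Measure.pi γ ≪ Measure.pi ν := by
  induction d with
  | zero => rw [Measure.pi_of_empty, Measure.pi_of_empty]
  | succ d ih =>
    have hγ := (measurePreserving_piFinSuccAbove γ 0).symm
    have hν := (measurePreserving_piFinSuccAbove ν 0).symm
    rw [← hγ.map_eq, ← hν.map_eq]
    exact ((h 0).prod (ih fun i => h _)).map hγ.measurable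

variable {E : Type*} [NormedAddCommGroup E] [MeasurableSpace E] [BorelSpace E]

theorem addHaar_seminorm_eq_const [NormedSpace ℝ E] [FiniteDimensional ℝ E] (ν : Measure E)
    [ν.IsAddHaarMeasure] (p : Seminorm ℝ E) {s : ℝ} (hs : s ≠ 0) : ν {x | p x = s} = 0 := by
  refine measure_mono_null (fun x (hx : p x = s) => ?_)
    ((p.convex_closedBall 0 s).addHaar_frontier ν)
  refine ⟨subset_closure (p.mem_closedBall_zero.2 hx.le), fun hint => ?_⟩
  have hs : 0 < s := lt_of_le_of_ne (hx ▸ apply_nonneg p x) hs.symm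
  have hlim : Tendsto (fun c : ℝ => c • x) (𝓝[>] 1) (𝓝 x) :=
    tendsto_nhdsWithin_of_tendsto_nhds <|
      (continuous_id.smul continuous_const).tendsto' 1 x (one_smul ℝ x)
  obtain ⟨c, hc, hc1 : 1 < c⟩ :=
    ((hlim.eventually (mem_interior_iff_mem_nhds.1 hint)).and self_mem_nhdsWithin).exists
  have hcs : c * s ≤ s := by
    simpa [map_smul_eq_mul, hx, abs_of_pos (one_pos.trans hc1)] using p.mem_closedBall_zero.1 hc
  exact hcs.not_gt (lt_mul_of_one_lt_left hs hc1)

variable [InnerProductSpace ℝ E] [FiniteDimensional ℝ E]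

theorem stdGaussian_absolutelyContinuous : stdGaussian E ≪ volume := by
  set b := stdOrthonormalBasis ℝ E
  have hvol : Measure.map (fun x => ∑ i, x i • b i) (Measure.pi fun _ => (volume : Measure ℝ)) =
      volume := by
    have h := (b.measurePreserving_repr_symm.comp (PiLp.volume_preserving_toLp _)).map_eq
    rw [← volume_pi, ← h]
    congr 1
    ext x
    simp [← b.sum_repr_symm]
  rw [stdGaussian_eq_map_pi_orthonormalBasis b, ← hvol]
  exact (absolutelyContinuous_pi fun _ => gaussianReal_absolutelyContinuous 0 one_ne_zero).map
    (by fun_prop)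

theorem stdGaussian_seminorm_eq_const (p : Seminorm ℝ E) {s : ℝ} (hs : s ≠ 0) :
    stdGaussian E {x | p x = s} = 0 :=
  stdGaussian_absolutelyContinuous (addHaar_seminorm_eq_const volume p hs)

end GaussianNullSets

section ChiSquare

variable {E : Type*} [NormedAddCommGroup E] [InnerProductSpace ℝ E] [FiniteDimensional ℝ E]
  [MeasurableSpace E] [BorelSpace E] {d : ℕ}

instance (d : ℕ) : IsProbabilityMeasure (chiSquare d) :=
  Measure.isProbabilityMeasure_map (Measurable.aemeasurable (by fun_prop))

lemma chiSquare_eq_map_stdGaussian (d : ℕ) :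
    chiSquare d = (stdGaussian (EuclideanSpace ℝ (Fin d))).map fun x => ‖x‖ ^ 2 := by
  rw [← map_pi_eq_stdGaussian, Measure.map_map (by fun_prop) (by fun_prop), chiSquare]
  congr 1
  ext z
  simp [EuclideanSpace.real_norm_sq_eq]

lemma chiSquare_Iic_zero (hd : d ≠ 0) : chiSquare d (Set.Iic 0) = 0 := by
  have : NeZero d := ⟨hd⟩
  have hpre : (fun x : EuclideanSpace ℝ (Fin d) => ‖x‖ ^ 2) ⁻¹' Set.Iic 0 = {0} := by
    ext x
    simp [sq_nonpos_iff]
  rw [chiSquare_eq_map_stdGaussian, Measure.map_apply (by fun_prop) measurableSet_Iic, hpre]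
  exact stdGaussian_absolutelyContinuous (measure_singleton 0)

lemma nullSingletonClass_chiSquare (hd : d ≠ 0) : NullSingletonClass (chiSquare d) where
  measure_singleton t := by
    rcases le_or_gt t 0 with ht | ht
    · exact measure_mono_null (by simpa using ht) (chiSquare_Iic_zero hd)
    rw [chiSquare_eq_map_stdGaussian, Measure.map_apply (by fun_prop) (measurableSet_singleton t)]
    refine measure_mono_null (fun x (hx : ‖x‖ ^ 2 = t) => ?_)
      (stdGaussian_seminorm_eq_const (normSeminorm ℝ _) (Real.sqrt_pos.2 ht).ne')
    simp [← hx]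

lemma continuous_cdf (ν : Measure ℝ) [IsProbabilityMeasure ν] [NullSingletonClass ν] :
    Continuous (cdf ν) := by
  refine continuous_iff_continuousAt.2 fun t => ?_
  have hjump := (cdf ν).measure_singleton t
  rw [measure_cdf, measure_singleton, eq_comm, ENNReal.ofReal_eq_zero, sub_nonpos] at hjump
  rw [(monotone_cdf ν).continuousAt_iff_leftLim_eq_rightLim, (cdf ν).rightLim_eq]
  exact le_antisymm ((monotone_cdf ν).leftLim_le le_rfl) hjump

theorem cdf_quantile (ν : Measure ℝ) [IsProbabilityMeasure ν] [NullSingletonClass ν] {u : ℝ}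
    (hu0 : 0 < u) (hu1 : u < 1) : cdf ν (quantile ν u) = u := by
  obtain ⟨a, ha⟩ := ((tendsto_cdf_atBot ν).eventually (gt_mem_nhds hu0)).exists
  obtain ⟨b, hb⟩ := ((tendsto_cdf_atTop ν).eventually (lt_mem_nhds hu1)).exists
  have hbdd : BddBelow {t : ℝ | u ≤ cdf ν t} :=
    ⟨a, fun t ht => le_of_not_gt fun h => (ht.trans (monotone_cdf ν h.le)).not_gt ha⟩
  refine le_antisymm ?_
    ((isClosed_le continuous_const (continuous_cdf ν)).csInf_mem ⟨b, hb.le⟩ hbdd)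
  have hlim : Tendsto (cdf ν) (𝓝[<] quantile ν u) (𝓝 (cdf ν (quantile ν u))) :=
    tendsto_nhdsWithin_of_tendsto_nhds ((continuous_cdf ν).tendsto _)
  refine le_of_tendsto hlim (eventually_nhdsWithin_of_forall fun t ht => ?_)
  exact le_of_not_ge fun h => (csInf_le hbdd h).not_gt ht

section Critical

variable {m : ℕ} {α : ℝ}

lemma chiSquare_Iic_critical (hm : 2 ≤ m) (hα0 : 0 < α) (hα1 : α < 1) :
    (chiSquare (m - 1)).real (Set.Iic (critical m α)) = 1 - α := by
  have := nullSingletonClass_chiSquare (d := m - 1) (by lia)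
  rw [← cdf_eq_real, critical, cdf_quantile _ (sub_pos.2 hα1) (sub_lt_self 1 hα0)]

lemma chiSquare_Ioi_critical (hm : 2 ≤ m) (hα0 : 0 < α) (hα1 : α < 1) :
    (chiSquare (m - 1)).real (Set.Ioi (critical m α)) = α := by
  rw [← Set.compl_Iic, probReal_compl_eq_one_sub measurableSet_Iic,
    chiSquare_Iic_critical hm hα0 hα1, sub_sub_cancel]

lemma critical_pos (hm : 2 ≤ m) (hα0 : 0 < α) (hα1 : α < 1) : 0 < critical m α := by
  by_contra! hneg
  have hnull : chiSquare (m - 1) (Set.Iic (critical m α)) = 0 :=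
    measure_mono_null (Set.Iic_subset_Iic.2 hneg) (chiSquare_Iic_zero (by lia))
  have hcrit := chiSquare_Iic_critical hm hα0 hα1
  rw [measureReal_def, hnull, ENNReal.toReal_zero] at hcrit
  linarith

end Critical

-- In an orthonormal basis whose first vector is `u`, the form is the sum of the squares of the
-- other coordinates.
theorem map_norm_sq_sub_inner_sq_stdGaussian (hE : Module.finrank ℝ E = d + 1) {u : E}
    (hu : ‖u‖ = 1) :
    (stdGaussian E).map (fun x => ‖x‖ ^ 2 - inner ℝ u x ^ 2) = chiSquare d := by
  obtain ⟨b, hb⟩ := Orthonormal.exists_orthonormalBasis_extension_of_card_eq (𝕜 := ℝ)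
    (ι := Fin (d + 1)) (by simpa using hE) (v := fun _ => u) (s := {0})
    ⟨fun _ => hu, fun i j hij => absurd (Subsingleton.elim i j) hij⟩
  have hb0 : b 0 = u := hb 0 rfl
  have hcoord : (fun x : E => ‖x‖ ^ 2 - inner ℝ u x ^ 2) ∘
        (fun z : Fin (d + 1) → ℝ => ∑ i, z i • b i) =
      (fun z : Fin d → ℝ => ∑ i, z i ^ 2) ∘ Prod.snd ∘
        MeasurableEquiv.piFinSuccAbove (fun _ => ℝ) 0 := by
    ext z
    have hnorm : ‖∑ i, z i • b i‖ ^ 2 = ∑ i, z i ^ 2 := by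
      simp only [← b.sum_sq_inner_right, b.orthonormal.inner_right_fintype]
    have hinner : inner ℝ u (∑ i, z i • b i) = z 0 := by
      rw [← hb0, b.orthonormal.inner_right_fintype]
    simp only [Function.comp_apply, hnorm, hinner]
    rw [Fin.sum_univ_succ, add_sub_cancel_left]
    simp [Fin.tail]
  rw [stdGaussian_eq_map_pi_orthonormalBasis b, Measure.map_map (by fun_prop) (by fun_prop),
    hcoord, ← Measure.map_map (by fun_prop) (by fun_prop),
    ← Measure.map_map (by fun_prop) (by fun_prop),
    (measurePreserving_piFinSuccAbove (fun _ : Fin (d + 1) => gaussianReal 0 1) 0).map_eq,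
    ← Measure.snd, Measure.snd_prod, chiSquare]

end ChiSquare

section GaussianVector

open scoped MatrixOrder

variable {ι : Type*} [Fintype ι] [DecidableEq ι] {S T : Matrix ι ι ℝ}

theorem norm_toEuclideanCLM_sqrt_sq (hS : S.PosSemidef) (x : EuclideanSpace ℝ ι) :
    ‖Matrix.toEuclideanCLM (𝕜 := ℝ) (CFC.sqrt S) x‖ ^ 2 = x.ofLp ⬝ᵥ S.mulVec x.ofLp := by
  have hsa : IsSelfAdjoint (Matrix.toEuclideanCLM (𝕜 := ℝ) (CFC.sqrt S)) :=
    (CFC.sqrt_nonneg S).isSelfAdjoint.map _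
  rw [← real_inner_self_eq_norm_sq, ← ContinuousLinearMap.adjoint_inner_right, hsa.adjoint_eq,
    ← ContinuousLinearMap.comp_apply, ← ContinuousLinearMap.mul_def, ← map_mul,
    CFC.sqrt_mul_sqrt_self _ hS.nonneg, Matrix.inner_toEuclideanCLM]

lemma multivariateGaussian_zero_eq_map_stdGaussian (S : Matrix ι ι ℝ) :
    multivariateGaussian 0 S = (stdGaussian (EuclideanSpace ℝ ι)).map
      (Matrix.toEuclideanCLM (𝕜 := ℝ) (CFC.sqrt S)) := by
  simp [multivariateGaussian]

theorem map_norm_sq_multivariateGaussian_zero (hS : S.PosSemidef) :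
    (multivariateGaussian 0 S).map (fun x => ‖x‖ ^ 2) =
      (stdGaussian (EuclideanSpace ℝ ι)).map fun x => x.ofLp ⬝ᵥ S.mulVec x.ofLp := by
  rw [multivariateGaussian_zero_eq_map_stdGaussian, Measure.map_map (by fun_prop) (by fun_prop)]
  congr 1
  ext x
  exact norm_toEuclideanCLM_sqrt_sq hS x

-- Both laws are images of the same standard Gaussian vector.
theorem multivariateGaussian_zero_real_lt_norm_sq_mono (hS : S.PosSemidef) (hT : T.PosSemidef)
    (hST : ∀ x : ι → ℝ, x ⬝ᵥ S.mulVec x ≤ x ⬝ᵥ T.mulVec x) (c : ℝ) :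
    (multivariateGaussian 0 S).real {x | c < ‖x‖ ^ 2} ≤
      (multivariateGaussian 0 T).real {x | c < ‖x‖ ^ 2} := by
  simp only [multivariateGaussian_zero_eq_map_stdGaussian]
  rw [map_measureReal_apply (by fun_prop) (measurableSet_lt (by fun_prop) (by fun_prop)),
    map_measureReal_apply (by fun_prop) (measurableSet_lt (by fun_prop) (by fun_prop))]
  simp only [Set.preimage_ofPred_eq, norm_toEuclideanCLM_sqrt_sq hS, norm_toEuclideanCLM_sqrt_sq hT]
  exact measureReal_mono fun x hx => lt_of_lt_of_le hx (hST x.ofLp)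

lemma multivariateGaussian_zero_norm_eq_const {s : ℝ} (hs : s ≠ 0) :
    multivariateGaussian 0 S {x | ‖x‖ = s} = 0 := by
  rw [multivariateGaussian_zero_eq_map_stdGaussian,
    Measure.map_apply (by fun_prop) (measurableSet_eq_fun (by fun_prop) (by fun_prop))]
  exact stdGaussian_seminorm_eq_const
    ((normSeminorm ℝ _).comp (Matrix.toEuclideanCLM (𝕜 := ℝ) (CFC.sqrt S)).toLinearMap) hs

theorem tendsto_measureReal_lt_norm_sq {κ Ω : Type*} [MeasurableSpace Ω] {μ : Measure Ω}
    [IsProbabilityMeasure μ] {l : Filter κ} {W : κ → Ω → EuclideanSpace ℝ ι}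
    (hW : TendstoInDistribution W l id (fun _ => μ) (multivariateGaussian 0 S)) {c : ℝ}
    (hc : 0 < c) :
    Tendsto (fun n => μ.real {ω | c < ‖W n ω‖ ^ 2}) l
      (𝓝 ((multivariateGaussian 0 S).real {x | c < ‖x‖ ^ 2})) := by
  have hmeas : MeasurableSet {x : EuclideanSpace ℝ ι | c < ‖x‖ ^ 2} :=
    measurableSet_lt measurable_const (by fun_prop)
  have hfrontier :
      multivariateGaussian 0 S (frontier {x : EuclideanSpace ℝ ι | c < ‖x‖ ^ 2}) = 0 := by
    refine measure_mono_null (fun x hx => ?_)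
      (multivariateGaussian_zero_norm_eq_const (S := S) (Real.sqrt_pos.2 hc).ne')
    have hxc : c = ‖x‖ ^ 2 :=
      frontier_lt_subset_eq (g := fun x => ‖x‖ ^ 2) continuous_const (by fun_prop) hx
    simp [hxc]
  have hlim := ProbabilityMeasure.tendsto_measure_of_null_frontier_of_tendsto' hW.tendsto
    (by simpa only [ProbabilityMeasure.coe_mk, Measure.map_id] using hfrontier)
  simp only [ProbabilityMeasure.coe_mk, Measure.map_id] at hlim
  refine ((ENNReal.tendsto_toReal (measure_ne_top _ _)).comp hlim).congr fun n => ?_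
  rw [Function.comp_apply, Measure.map_apply_of_aemeasurable (hW.forall_aemeasurable n) hmeas]
  rfl

end GaussianVector

section Covariance

variable {ι 𝒳 : Type*} [MeasurableSpace 𝒳] {P : Measure 𝒳} {g : ι → 𝒳 → ℝ}

/-- The covariance matrix under `P` of a family of functions. -/
def covMatrix (P : Measure 𝒳) (g : ι → 𝒳 → ℝ) : Matrix ι ι ℝ :=
  Matrix.of fun i j => cov[g i, g j; P]

variable [IsFiniteMeasure P]

theorem dotProduct_covMatrix_mulVec [Fintype ι] (hg : ∀ i, MemLp (g i) 2 P) (t : ι → ℝ) :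
    t ⬝ᵥ (covMatrix P g).mulVec t = Var[fun x => ∑ i, t i * g i x; P] := by
  rw [variance_fun_sum fun i => (hg i).const_mul (t i)]
  simp only [dotProduct, Matrix.mulVec, covMatrix, Matrix.of_apply, Finset.mul_sum,
    covariance_const_mul_left, covariance_const_mul_right]
  exact Finset.sum_congr rfl fun i _ => Finset.sum_congr rfl fun j _ => by ring

lemma posSemidef_covMatrix [Finite ι] (hg : ∀ i, MemLp (g i) 2 P) :
    (covMatrix P g).PosSemidef := by
  have := Fintype.ofFinite ι
  refine Matrix.PosSemidef.of_dotProduct_mulVec_nonneg ?_ fun t => ?_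
  · ext i j
    simp [covMatrix, covariance_comm]
  · rw [star_trivial, dotProduct_covMatrix_mulVec hg]
    exact variance_nonneg _ _

end Covariance

section CramerWold

variable {E : Type*} [NormedAddCommGroup E] [InnerProductSpace ℝ E] [MeasurableSpace E]
  [BorelSpace E]

lemma charFun_map_inner {Ω : Type*} [MeasurableSpace Ω] {μ : Measure Ω} {V : Ω → E}
    (hV : AEMeasurable V μ) (t : E) (s : ℝ) :
    charFun (μ.map fun ω => inner ℝ t (V ω)) s = charFun (μ.map V) (s • t) := by
  rw [charFun_apply, charFun_apply, integral_map (by fun_prop) (by fun_prop),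
    integral_map hV (by fun_prop)]
  simp [inner_smul_right, real_inner_comm]

theorem tendstoInDistribution_of_inner [FiniteDimensional ℝ E] {Ω Ω' : Type*} [MeasurableSpace Ω]
    [MeasurableSpace Ω'] {μ : Measure Ω} {ν : Measure Ω'} [IsProbabilityMeasure μ]
    [IsProbabilityMeasure ν] {W : ℕ → Ω → E} {Z : Ω' → E} (hW : ∀ n, AEMeasurable (W n) μ)
    (hZ : AEMeasurable Z ν)
    (h : ∀ t, TendstoInDistribution (fun n ω => inner ℝ t (W n ω)) atTop
      (fun ω => inner ℝ t (Z ω)) (fun _ => μ) ν) :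
    TendstoInDistribution W atTop Z (fun _ => μ) ν where
  forall_aemeasurable := hW
  aemeasurable_limit := hZ
  tendsto := by
    refine ProbabilityMeasure.tendsto_iff_tendsto_charFun.2 fun t => ?_
    have hone := ProbabilityMeasure.tendsto_iff_tendsto_charFun.1 (h t).tendsto 1
    simpa only [ProbabilityMeasure.coe_mk, charFun_map_inner hZ, charFun_map_inner (hW _),
      one_smul] using hone

theorem map_inner_multivariateGaussian_zero {ι : Type*} [Fintype ι] [DecidableEq ι]
    {S : Matrix ι ι ℝ} (hS : S.PosSemidef) (t : EuclideanSpace ℝ ι) :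
    (multivariateGaussian 0 S).map (fun x => inner ℝ t x) =
      gaussianReal 0 (t.ofLp ⬝ᵥ S.mulVec t.ofLp).toNNReal := by
  refine Measure.ext_of_charFun (funext fun s => ?_)
  have hnonneg : 0 ≤ t.ofLp ⬝ᵥ S.mulVec t.ofLp := by
    simpa using hS.dotProduct_mulVec_nonneg t.ofLp
  rw [charFun_map_inner (V := fun x => x) aemeasurable_id, Measure.map_id',
    charFun_multivariateGaussian hS, charFun_gaussianReal]
  simp only [inner_zero_right, WithLp.ofLp_smul, Matrix.mulVec_smul,
    dotProduct_smul, smul_dotProduct, Real.coe_toNNReal _ hnonneg]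
  congr 1
  push_cast
  simp
  ring

end CramerWold

section Fluctuation

variable {𝒳 : Type*} [MeasurableSpace 𝒳] {P : Measure 𝒳} {Q : (𝒳 → ℝ) → ℝ} {ι : Type*}

/-- The normalized fluctuation `√n (Q(f) - P(f))` of an estimate `Q` of the law `P`. -/
def fluctuation (P : Measure 𝒳) (n : ℕ) (Q : (𝒳 → ℝ) → ℝ) (f : 𝒳 → ℝ) : ℝ :=
  √n * (Q f - ∫ x, f x ∂P)

/-- The vector of the normalized fluctuations of the functions `g i`. -/
def fluctuationVec (P : Measure 𝒳) (n : ℕ) (Q : (𝒳 → ℝ) → ℝ) (g : ι → 𝒳 → ℝ) :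
    EuclideanSpace ℝ ι :=
  WithLp.toLp 2 fun i => fluctuation P n Q (g i)

lemma fluctuation_finsetSum_smul (hQ : IsLinearMap ℝ Q) (n : ℕ) (s : Finset ι) (c : ι → ℝ)
    {g : ι → 𝒳 → ℝ} (hg : ∀ i ∈ s, Integrable (g i) P) :
    fluctuation P n Q (∑ i ∈ s, c i • g i) = ∑ i ∈ s, c i * fluctuation P n Q (g i) := by
  have hQsum : Q (∑ i ∈ s, c i • g i) = ∑ i ∈ s, c i * Q (g i) := by
    refine (map_sum (hQ.mk' Q) (fun i => c i • g i) s).trans ?_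
    exact Finset.sum_congr rfl fun i _ => hQ.map_smul (c i) (g i)
  have hPsum : ∫ x, (∑ i ∈ s, c i • g i) x ∂P = ∑ i ∈ s, c i * ∫ x, g i x ∂P := by
    simp only [Finset.sum_apply, Pi.smul_apply, smul_eq_mul]
    rw [integral_finsetSum _ fun i hi => (hg i hi).const_mul (c i)]
    simp only [integral_const_mul]
  rw [fluctuation, hQsum, hPsum, ← Finset.sum_sub_distrib, Finset.mul_sum]
  exact Finset.sum_congr rfl fun i _ => by rw [fluctuation]; ring

lemma inner_fluctuationVec [Fintype ι] (hQ : IsLinearMap ℝ Q) (n : ℕ) {g : ι → 𝒳 → ℝ}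
    (hg : ∀ i, Integrable (g i) P) (t : EuclideanSpace ℝ ι) :
    inner ℝ t (fluctuationVec P n Q g) = fluctuation P n Q (∑ i, t i • g i) := by
  rw [fluctuation_finsetSum_smul hQ n _ _ fun i _ => hg i]
  simp [PiLp.inner_apply, fluctuationVec, mul_comm]

end Fluctuation

section Empirical

variable {Ω 𝒳 ι : Type*} [MeasurableSpace Ω] [MeasurableSpace 𝒳] {μ : Measure Ω}
  {P : Measure 𝒳} {X : ℕ → Ω → 𝒳} {f : 𝒳 → ℝ} {g : ι → 𝒳 → ℝ}

omit [MeasurableSpace 𝒳] in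
lemma isLinearMap_empirical (x : ℕ → 𝒳) (n : ℕ) : IsLinearMap ℝ (empirical x n) where
  map_add f g := by simp [empirical, Finset.sum_add_distrib, add_div]
  map_smul c f := by simp [empirical, ← Finset.mul_sum, mul_div_assoc]

lemma fluctuation_empirical (x : ℕ → 𝒳) (n : ℕ) (f : 𝒳 → ℝ) :
    fluctuation P n (empirical x n) f =
      (√n)⁻¹ * (∑ k ∈ Finset.range n, f (x k) - n * ∫ y, f y ∂P) := by
  rcases n.eq_zero_or_pos with rfl | hn
  · simp [fluctuation]
  have hn' : (0 : ℝ) < n := by exact_mod_cast hn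
  have hsqrt : √(n : ℝ) ^ 2 = n := Real.sq_sqrt hn'.le
  rw [fluctuation, empirical]
  field_simp
  rw [hsqrt]

lemma aemeasurable_empirical (hX : ∀ i, AEMeasurable (X i) μ) (hf : Measurable f) (n : ℕ) :
    AEMeasurable (fun ω => empirical (fun i => X i ω) n f) μ :=
  (Finset.aemeasurable_fun_sum _ fun i _ => hf.comp_aemeasurable (hX i)).div_const _

lemma aemeasurable_fluctuationVec_empirical [Finite ι] (hX : ∀ i, AEMeasurable (X i) μ)
    (hg : ∀ i, Measurable (g i)) (n : ℕ) :
    AEMeasurable (fun ω => fluctuationVec P n (empirical (fun i => X i ω) n) g) μ :=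
  (WithLp.measurable_toLp 2 _).comp_aemeasurable <| aemeasurable_pi_lambda _ fun i =>
    ((aemeasurable_empirical hX (hg i) n).sub_const _).const_mul _

variable (hX_indep : iIndepFun X μ) (hX_law : ∀ i, HasLaw (X i) P μ)

include hX_law in
lemma identDistrib_comp (hf : Measurable f) (i j : ℕ) :
    IdentDistrib (fun ω => f (X i ω)) (fun ω => f (X j ω)) μ μ :=
  IdentDistrib.comp ⟨(hX_law i).aemeasurable, (hX_law j).aemeasurable,
    (hX_law i).map_eq.trans (hX_law j).map_eq.symm⟩ hf

include hX_indep hX_law in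
theorem ae_tendsto_empirical (hf : Measurable f) (hfP : Integrable f P) :
    ∀ᵐ ω ∂μ, Tendsto (fun n => empirical (fun i => X i ω) n f) atTop (𝓝 (∫ x, f x ∂P)) := by
  have hint : Integrable (fun ω => f (X 0 ω)) μ :=
    ((hX_law 0).map_eq ▸ hfP).comp_aemeasurable (hX_law 0).aemeasurable
  have hlim := strong_law_ae_real (fun i ω => f (X i ω)) hint
    (fun i j hij => (hX_indep.indepFun hij).comp hf hf)
    fun i => identDistrib_comp hX_law hf i 0
  rwa [← (hX_law 0).integral_comp hf.aestronglyMeasurable]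

variable [IsProbabilityMeasure μ]

include hX_indep hX_law in
theorem tendstoInDistribution_fluctuation_empirical (hf : Measurable f) (hfP : MemLp f 2 P)
    {Ω' : Type*} [MeasurableSpace Ω'] {ν : Measure Ω'} [IsProbabilityMeasure ν] {Z : Ω' → ℝ}
    (hZ : HasLaw Z (gaussianReal 0 Var[f; P].toNNReal) ν) :
    TendstoInDistribution (fun n ω => fluctuation P n (empirical (fun i => X i ω) n) f) atTop Z
      (fun _ => μ) ν := by
  have hvar : Var[fun ω => f (X 0 ω); μ] = Var[f; P] :=
    (variance_map hf.aemeasurable (hX_law 0).aemeasurable).symm.trans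
      (by rw [(hX_law 0).map_eq])
  have hmean : ∫ ω, f (X 0 ω) ∂μ = ∫ x, f x ∂P :=
    (hX_law 0).integral_comp hf.aestronglyMeasurable
  have hL2 : MemLp (fun ω => f (X 0 ω)) 2 μ :=
    ((hX_law 0).map_eq ▸ hfP).comp_of_map (hX_law 0).aemeasurable
  have hclt := tendstoInDistribution_inv_sqrt_mul_sum_sub (X := fun i ω => f (X i ω))
    (hvar.symm ▸ hZ) hL2 (hX_indep.comp (fun _ => f) fun _ => hf)
    fun i => identDistrib_comp hX_law hf i 0
  simpa only [fluctuation_empirical, hmean] using hclt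

include hX_indep hX_law in
theorem tendstoInDistribution_fluctuationVec_empirical [Fintype ι] [DecidableEq ι]
    (hg : ∀ i, Measurable (g i)) (hgP : ∀ i, MemLp (g i) 2 P) :
    TendstoInDistribution (fun n ω => fluctuationVec P n (empirical (fun i => X i ω) n) g) atTop id
      (fun _ => μ) (multivariateGaussian 0 (covMatrix P g)) := by
  have : IsProbabilityMeasure P := (hX_law 0).isProbabilityMeasure_iff.1 ‹_›
  refine tendstoInDistribution_of_inner
    (aemeasurable_fluctuationVec_empirical (fun i => (hX_law i).aemeasurable) hg)
    aemeasurable_id fun t => ?_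
  simp only [inner_fluctuationVec (isLinearMap_empirical _ _) _
    fun i => (hgP i).integrable one_le_two, id]
  refine tendstoInDistribution_fluctuation_empirical hX_indep hX_law (by fun_prop)
    (memLp_finsetSum' _ fun i _ => (hgP i).const_smul (t i))
    ⟨(by fun_prop : Measurable fun x => inner ℝ t x).aemeasurable, ?_⟩
  rw [map_inner_multivariateGaussian_zero (posSemidef_covMatrix hgP),
    dotProduct_covMatrix_mulVec hgP]
  congr 3
  ext x
  simp

end Empirical

section Partition

variable {𝒳 : Type*} [MeasurableSpace 𝒳] {P : Measure 𝒳} {m : ℕ} {A : Fin m → Set 𝒳} {f : 𝒳 → ℝ}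

lemma IsMeasurablePartition.sum_indicator (hA : IsMeasurablePartition A) (f : 𝒳 → ℝ) :
    ∑ j, (A j).indicator f = f := by
  ext x
  obtain ⟨j, hj⟩ := Set.mem_iUnion.1 (hA.iUnion_eq ▸ Set.mem_univ x)
  rw [Finset.sum_apply, Finset.sum_eq_single j _ (by simp), Set.indicator_of_mem hj]
  exact fun i _ hij => Set.indicator_of_notMem
    (Set.disjoint_right.1 (hA.pairwise_disjoint hij) hj) _

lemma IsMeasurablePartition.indicator_sum_indicator (hA : IsMeasurablePartition A)
    (g : Fin m → 𝒳 → ℝ) (i : Fin m) :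
    (A i).indicator (∑ j, (A j).indicator (g j)) = (A i).indicator (g i) := by
  refine Set.indicator_congr fun x hx => ?_
  rw [Finset.sum_apply, Finset.sum_eq_single i _ (by simp), Set.indicator_of_mem hx]
  exact fun j _ hji => Set.indicator_of_notMem
    (Set.disjoint_right.1 (hA.pairwise_disjoint hji) hx) _

lemma IsMeasurablePartition.integral_eq_sum (hA : IsMeasurablePartition A)
    (hf : Integrable f P) : ∫ x, f x ∂P = ∑ j, ∫ x in A j, f x ∂P := by
  rw [← integral_iUnion_fintype hA.measurableSet hA.pairwise_disjoint fun j => hf.integrableOn,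
    hA.iUnion_eq, setIntegral_univ]

lemma IsMeasurablePartition.sum_measureReal [IsProbabilityMeasure P]
    (hA : IsMeasurablePartition A) : ∑ j, P.real (A j) = 1 := by
  rw [← measureReal_iUnion_fintype hA.pairwise_disjoint hA.measurableSet, hA.iUnion_eq,
    probReal_univ]

end Partition

section CondCentered

variable {𝒳 ι : Type*} [MeasurableSpace 𝒳] {P : Measure 𝒳} {m : ℕ} {A : Fin m → Set 𝒳}
  {f : 𝒳 → ℝ}

/-- The function `f` minus its conditional expectation given a finite partition, written cell by
cell. -/
def condCentered (P : Measure 𝒳) (A : Fin m → Set 𝒳) (f : 𝒳 → ℝ) : 𝒳 → ℝ :=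
  ∑ j, (A j).indicator fun x => f x - ⨍ y in A j, f y ∂P

lemma measurable_condCentered (hA : ∀ j, MeasurableSet (A j)) (hf : Measurable f) :
    Measurable (condCentered P A f) := by
  have hcell (j : Fin m) := (hf.sub_const (⨍ y in A j, f y ∂P)).indicator (hA j)
  unfold condCentered
  fun_prop

lemma condCentered_finsetSum_smul (s : Finset ι) (c : ι → ℝ) {g : ι → 𝒳 → ℝ}
    (hg : ∀ i ∈ s, Integrable (g i) P) :
    condCentered P A (∑ i ∈ s, c i • g i) = ∑ i ∈ s, c i • condCentered P A (g i) := by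
  have hmean (j : Fin m) : ⨍ x in A j, (∑ i ∈ s, c i • g i) x ∂P =
      ∑ i ∈ s, c i * ⨍ x in A j, g i x ∂P := by
    simp only [Finset.sum_apply, Pi.smul_apply, smul_eq_mul, average_eq]
    rw [integral_finsetSum _ fun i hi => (hg i hi).integrableOn.const_mul (c i), Finset.mul_sum]
    exact Finset.sum_congr rfl fun i _ => by rw [integral_const_mul]; ring
  simp only [condCentered, hmean, Finset.smul_sum]
  rw [Finset.sum_comm]
  refine Finset.sum_congr rfl fun j _ => ?_
  ext x
  by_cases hx : x ∈ A j <;> simp [hx, mul_sub, Finset.sum_sub_distrib]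

lemma memLp_condCentered [IsFiniteMeasure P] (hA : ∀ j, MeasurableSet (A j)) {p : ENNReal}
    (hf : MemLp f p P) : MemLp (condCentered P A f) p P :=
  memLp_finsetSum' _ fun j _ => (hf.sub (memLp_const _)).indicator (hA j)

lemma setIntegral_condCentered [IsFiniteMeasure P] (hA : IsMeasurablePartition A) (j : Fin m) :
    ∫ x in A j, condCentered P A f x ∂P = 0 := by
  rw [← integral_indicator (hA.measurableSet j), condCentered, hA.indicator_sum_indicator,
    integral_indicator (hA.measurableSet j), integral_sub_average]

lemma integral_condCentered [IsFiniteMeasure P] (hA : IsMeasurablePartition A)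
    (hf : Integrable f P) : ∫ x, condCentered P A f x ∂P = 0 := by
  have hint : Integrable (condCentered P A f) P :=
    memLp_one_iff_integrable.1 (memLp_condCentered hA.measurableSet (memLp_one_iff_integrable.2 hf))
  rw [hA.integral_eq_sum hint]
  exact Finset.sum_eq_zero fun j _ => setIntegral_condCentered hA j

lemma covariance_condCentered_indicator [IsProbabilityMeasure P] (hA : IsMeasurablePartition A)
    (hf : MemLp f 2 P) (j : Fin m) (a : ℝ) :
    cov[condCentered P A f, (A j).indicator fun _ => a; P] = 0 := by
  have hprod : condCentered P A f * (A j).indicator (fun _ => a) =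
      (A j).indicator fun x => condCentered P A f x * a := by
    ext x
    by_cases hx : x ∈ A j <;> simp [hx]
  rw [covariance_eq_sub (memLp_condCentered hA.measurableSet hf)
    ((memLp_const a).indicator (hA.measurableSet j)), hprod,
    integral_indicator (hA.measurableSet j), integral_mul_const, setIntegral_condCentered hA,
    integral_condCentered hA (hf.integrable one_le_two)]
  simp

theorem variance_condCentered_le [IsProbabilityMeasure P] (hA : IsMeasurablePartition A)
    (hf : MemLp f 2 P) : Var[condCentered P A f; P] ≤ Var[f; P] := by
  set r : 𝒳 → ℝ := ∑ j, (A j).indicator fun _ => ⨍ y in A j, f y ∂P with hr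
  have hind (j : Fin m) : MemLp ((A j).indicator fun _ => ⨍ y in A j, f y ∂P) 2 P :=
    (memLp_const _).indicator (hA.measurableSet j)
  have hsplit : f = condCentered P A f + r := by
    rw [condCentered, hr, ← Finset.sum_add_distrib]
    conv_lhs => rw [← hA.sum_indicator f]
    refine Finset.sum_congr rfl fun j _ => ?_
    rw [← Set.indicator_add']
    congr 1
    ext x
    simp
  have horth : cov[condCentered P A f, r; P] = 0 := by
    rw [hr, covariance_sum_right hind (memLp_condCentered hA.measurableSet hf)]
    exact Finset.sum_eq_zero fun j _ => covariance_condCentered_indicator hA hf j _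
  calc Var[condCentered P A f; P] ≤ Var[condCentered P A f; P] + Var[r; P] :=
        le_add_of_nonneg_right (variance_nonneg _ _)
    _ = Var[f; P] := by
        conv_rhs => rw [hsplit, variance_add (memLp_condCentered hA.measurableSet hf)
          (memLp_finsetSum' _ fun j _ => hind j), horth]
        ring

end CondCentered

section IterCentered

variable {𝒳 ι : Type*} [MeasurableSpace 𝒳] {P : Measure 𝒳} {mA : ℕ → ℕ}
  {A : (k : ℕ) → Fin (mA k) → Set 𝒳} {N : ℕ} {f : 𝒳 → ℝ}

/-- The successive conditional centerings of `f`, first given `A N` and last given `A 1`: to first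
order, raking with `A 1, …, A N` acts on fluctuations by this map. -/
def iterCentered (P : Measure 𝒳) (A : (k : ℕ) → Fin (mA k) → Set 𝒳) : ℕ → (𝒳 → ℝ) → 𝒳 → ℝ
  | 0, f => f
  | k + 1, f => iterCentered P A k (condCentered P (A (k + 1)) f)

omit [MeasurableSpace 𝒳] in
lemma forall_mem_Icc_one_succ {p : ℕ → Prop} :
    (∀ k ∈ Set.Icc 1 (N + 1), p k) ↔ (∀ k ∈ Set.Icc 1 N, p k) ∧ p (N + 1) := by
  refine ⟨fun h => ⟨fun k hk => h k ⟨hk.1, by grind⟩, h _ ⟨by omega, le_rfl⟩⟩, fun h k hk => ?_⟩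
  rcases hk.2.eq_or_lt with rfl | hlt
  · exact h.2
  · exact h.1 k ⟨hk.1, Nat.lt_succ_iff.1 hlt⟩

lemma measurable_iterCentered (hA : ∀ k ∈ Set.Icc 1 N, ∀ j, MeasurableSet (A k j))
    (hf : Measurable f) : Measurable (iterCentered P A N f) := by
  induction N generalizing f with
  | zero => exact hf
  | succ N ih =>
    obtain ⟨hAN, hA'⟩ := forall_mem_Icc_one_succ.1 hA
    exact ih hAN (measurable_condCentered hA' hf)

lemma memLp_iterCentered [IsFiniteMeasure P]
    (hA : ∀ k ∈ Set.Icc 1 N, ∀ j, MeasurableSet (A k j)) {p : ENNReal}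
    (hf : MemLp f p P) : MemLp (iterCentered P A N f) p P := by
  induction N generalizing f with
  | zero => exact hf
  | succ N ih =>
    obtain ⟨hAN, hA'⟩ := forall_mem_Icc_one_succ.1 hA
    exact ih hAN (memLp_condCentered hA' hf)

lemma iterCentered_finsetSum_smul [IsFiniteMeasure P]
    (hA : ∀ k ∈ Set.Icc 1 N, ∀ j, MeasurableSet (A k j))
    (s : Finset ι) (c : ι → ℝ) {g : ι → 𝒳 → ℝ} (hg : ∀ i ∈ s, Integrable (g i) P) :
    iterCentered P A N (∑ i ∈ s, c i • g i) = ∑ i ∈ s, c i • iterCentered P A N (g i) := by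
  induction N generalizing g with
  | zero => rfl
  | succ N ih =>
    obtain ⟨hAN, hA'⟩ := forall_mem_Icc_one_succ.1 hA
    rw [iterCentered, condCentered_finsetSum_smul s c hg, ih hAN fun i hi =>
      memLp_one_iff_integrable.1 (memLp_condCentered hA' (memLp_one_iff_integrable.2 (hg i hi)))]
    rfl

theorem variance_iterCentered_le [IsProbabilityMeasure P]
    (hA : ∀ k ∈ Set.Icc 1 N, IsMeasurablePartition (A k)) (hf : MemLp f 2 P) :
    Var[iterCentered P A N f; P] ≤ Var[f; P] := by
  induction N generalizing f with
  | zero => exact le_rfl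
  | succ N ih =>
    obtain ⟨hAN, hA'⟩ := forall_mem_Icc_one_succ.1 hA
    exact (ih hAN (memLp_condCentered hA'.measurableSet hf)).trans (variance_condCentered_le hA' hf)

theorem dotProduct_covMatrix_iterCentered_mulVec_le [IsProbabilityMeasure P] [Fintype ι]
    (hA : ∀ k ∈ Set.Icc 1 N, IsMeasurablePartition (A k)) {g : ι → 𝒳 → ℝ}
    (hg : ∀ i, MemLp (g i) 2 P) (t : ι → ℝ) :
    t ⬝ᵥ (covMatrix P fun i => iterCentered P A N (g i)).mulVec t ≤
      t ⬝ᵥ (covMatrix P g).mulVec t := by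
  have hAm : ∀ k ∈ Set.Icc 1 N, ∀ j, MeasurableSet (A k j) := fun k hk => (hA k hk).measurableSet
  have hsum (h : ι → 𝒳 → ℝ) : (fun x => ∑ i, t i * h i x) = ∑ i, t i • h i := by
    ext x
    simp
  rw [dotProduct_covMatrix_mulVec fun i => memLp_iterCentered hAm (hg i),
    dotProduct_covMatrix_mulVec hg, hsum, hsum,
    ← iterCentered_finsetSum_smul hAm _ _ fun i _ => (hg i).integrable one_le_two]
  exact variance_iterCentered_le hA (memLp_finsetSum' _ fun i _ => (hg i).const_smul (t i))

end IterCentered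

section Rake

variable {κ 𝒳 : Type*} {m : ℕ} {A : Fin m → Set 𝒳} {f : 𝒳 → ℝ} {p : Fin m → ℝ}
  {Q : (𝒳 → ℝ) → ℝ}

/-- One raking step: the estimate `Q` rescaled on each cell `A j` so as to give it mass `p j`. -/
def rake (A : Fin m → Set 𝒳) (p : Fin m → ℝ) (Q : (𝒳 → ℝ) → ℝ) (f : 𝒳 → ℝ) : ℝ :=
  ∑ j, p j / Q ((A j).indicator 1) * Q ((A j).indicator f)

lemma isLinearMap_rake (hQ : IsLinearMap ℝ Q) : IsLinearMap ℝ (rake A p Q) where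
  map_add f g := by
    simp only [rake, Set.indicator_add', hQ.map_add, mul_add, Finset.sum_add_distrib]
  map_smul c f := by
    have hsmul (j : Fin m) : (A j).indicator (c • f) = c • (A j).indicator f :=
      Set.indicator_const_smul (A j) c f
    simp only [rake, hsmul, hQ.map_smul, smul_eq_mul, Finset.mul_sum]
    exact Finset.sum_congr rfl fun j _ => mul_left_comm _ _ _

variable [MeasurableSpace 𝒳] {P : Measure 𝒳} {l : Filter κ}

theorem tendsto_rake (hA : IsMeasurablePartition A) (hA_pos : ∀ j, P.real (A j) ≠ 0)
    (hf : Integrable f P) {w : κ → Fin m → ℝ} {Q : κ → (𝒳 → ℝ) → ℝ}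
    (hw : ∀ j, Tendsto (fun z => w z j) l (𝓝 (P.real (A j))))
    (hQ_cell : ∀ j, Tendsto (fun z => Q z ((A j).indicator 1)) l (𝓝 (P.real (A j))))
    (hQ : ∀ j, Tendsto (fun z => Q z ((A j).indicator f)) l (𝓝 (∫ x in A j, f x ∂P))) :
    Tendsto (fun z => rake A (w z) (Q z) f) l (𝓝 (∫ x, f x ∂P)) := by
  rw [hA.integral_eq_sum hf]
  refine tendsto_finsetSum _ fun j _ => ?_
  simpa only [Pi.div_apply, div_self (hA_pos j), one_mul] using
    ((hw j).div (hQ_cell j) (hA_pos j)).mul (hQ j)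

lemma fluctuation_condCentered [IsFiniteMeasure P] (hA : ∀ j, MeasurableSet (A j))
    (hQ : IsLinearMap ℝ Q) (hf : Integrable f P) (n : ℕ) :
    fluctuation P n Q (condCentered P A f) =
      ∑ j, fluctuation P n Q ((A j).indicator fun x => f x - ⨍ y in A j, f y ∂P) := by
  simpa only [condCentered, one_smul, one_mul] using
    fluctuation_finsetSum_smul hQ n Finset.univ (fun _ => 1)
      (g := fun j => (A j).indicator fun x => f x - ⨍ y in A j, f y ∂P)
      fun j _ => (hf.sub (integrable_const _)).indicator (hA j)

theorem fluctuation_rake [IsFiniteMeasure P] (hA : IsMeasurablePartition A)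
    (hQ : IsLinearMap ℝ Q) (hQ_cell : ∀ j, Q ((A j).indicator 1) ≠ 0) (hf : Integrable f P)
    (n : ℕ) :
    fluctuation P n (rake A p Q) f =
      ∑ j, (p j / Q ((A j).indicator 1) *
          fluctuation P n Q ((A j).indicator fun x => f x - ⨍ y in A j, f y ∂P) +
        √n * (p j - P.real (A j)) * ⨍ y in A j, f y ∂P) := by
  have hQcentered (j : Fin m) : Q ((A j).indicator fun x => f x - ⨍ y in A j, f y ∂P) =
      Q ((A j).indicator f) - (⨍ y in A j, f y ∂P) * Q ((A j).indicator 1) := by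
    rw [← smul_eq_mul, ← hQ.map_smul, ← hQ.map_sub]
    congr 1
    ext x
    by_cases hx : x ∈ A j <;> simp [hx]
  have hPcentered (j : Fin m) :
      ∫ x, (A j).indicator (fun x => f x - ⨍ y in A j, f y ∂P) x ∂P = 0 := by
    rw [integral_indicator (hA.measurableSet j), integral_sub_average]
  have hPf : ∫ x, f x ∂P = ∑ j, P.real (A j) * ⨍ y in A j, f y ∂P := by
    rw [hA.integral_eq_sum hf]
    exact Finset.sum_congr rfl fun j _ => (measure_smul_setAverage f (measure_ne_top P _)).symm
  rw [fluctuation, rake, hPf, ← Finset.sum_sub_distrib, Finset.mul_sum]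
  refine Finset.sum_congr rfl fun j _ => ?_
  rw [fluctuation, hQcentered, hPcentered]
  field_simp [hQ_cell j]
  ring

/-- Boundedness of `Y` along `l` in the sense that `o(1) * Y = o(1)`; along `inProbability μ l`
this is boundedness in probability. -/
def IsTightAlong (l : Filter κ) (Y : κ → ℝ) : Prop :=
  ∀ c : κ → ℝ, Tendsto c l (𝓝 0) → Tendsto (fun z => c z * Y z) l (𝓝 0)

lemma IsTightAlong.of_tendsto {Y : κ → ℝ} {a : ℝ} (h : Tendsto Y l (𝓝 a)) : IsTightAlong l Y :=
  fun c hc => by simpa only [zero_mul] using hc.mul h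

lemma IsTightAlong.add {Y Y' : κ → ℝ} (h : IsTightAlong l Y) (h' : IsTightAlong l Y') :
    IsTightAlong l fun z => Y z + Y' z :=
  fun c hc => by simpa only [mul_add, add_zero] using (h c hc).add (h' c hc)

lemma tendsto_of_isTightAlong_sqrt_mul_sub {n : κ → ℕ} (hn : Tendsto n l atTop) {Y : κ → ℝ}
    {a : ℝ} (h : IsTightAlong l fun z => √(n z) * (Y z - a)) : Tendsto Y l (𝓝 a) := by
  have hinv : Tendsto (fun z => (√(n z : ℝ))⁻¹) l (𝓝 0) := tendsto_inv_atTop_zero.comp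
    (Real.tendsto_sqrt_atTop.comp (tendsto_natCast_atTop_atTop.comp hn))
  refine tendsto_sub_nhds_zero_iff.1 ((h _ hinv).congr' ?_)
  filter_upwards [hn.eventually_gt_atTop 0] with z hz
  exact inv_mul_cancel_left₀ (Real.sqrt_ne_zero'.2 (Nat.cast_pos.2 hz)) _

theorem tendsto_fluctuation_rake_sub [IsFiniteMeasure P] {n : κ → ℕ} (hn : Tendsto n l atTop)
    (hA : IsMeasurablePartition A) (hA_pos : ∀ j, P.real (A j) ≠ 0) (hf : Integrable f P)
    {w : κ → Fin m → ℝ} (hw : ∀ j, Tendsto (fun z => √(n z) * (w z j - P.real (A j))) l (𝓝 0))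
    {Q : κ → (𝒳 → ℝ) → ℝ} (hQ : ∀ z, IsLinearMap ℝ (Q z))
    (hQ_cell : ∀ j, IsTightAlong l fun z => fluctuation P (n z) (Q z) ((A j).indicator 1))
    (hQ_tight : ∀ j, IsTightAlong l fun z =>
      fluctuation P (n z) (Q z) ((A j).indicator fun x => f x - ⨍ y in A j, f y ∂P)) :
    Tendsto (fun z => fluctuation P (n z) (rake A (w z) (Q z)) f -
      fluctuation P (n z) (Q z) (condCentered P A f)) l (𝓝 0) := by
  have hcell (j : Fin m) :
      Tendsto (fun z => Q z ((A j).indicator 1)) l (𝓝 (P.real (A j))) := by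
    rw [← integral_indicator_one (hA.measurableSet j)]
    exact tendsto_of_isTightAlong_sqrt_mul_sub hn (hQ_cell j)
  have hratio (j : Fin m) :
      Tendsto (fun z => w z j / Q z ((A j).indicator 1) - 1) l (𝓝 0) := by
    simpa only [Pi.div_apply, div_self (hA_pos j), sub_self] using
      ((tendsto_of_isTightAlong_sqrt_mul_sub hn (.of_tendsto (hw j))).div (hcell j)
        (hA_pos j)).sub_const 1
  have hlim := tendsto_finsetSum Finset.univ fun j _ =>
    (hQ_tight j _ (hratio j)).add ((hw j).mul_const (⨍ y in A j, f y ∂P))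
  simp only [zero_mul, add_zero, Finset.sum_const_zero] at hlim
  refine hlim.congr' ?_
  filter_upwards [eventually_all.2 fun j => (hcell j).eventually_ne (hA_pos j)] with z hz
  rw [fluctuation_rake hA (hQ z) hz hf, fluctuation_condCentered hA.measurableSet (hQ z) hf,
    ← Finset.sum_sub_distrib]
  exact Finset.sum_congr rfl fun j _ => by ring

end Rake

section Raked

variable {Ω 𝒳 ι : Type*} [MeasurableSpace Ω] [MeasurableSpace 𝒳] {μ : Measure Ω}
  {P : Measure 𝒳} {X : ℕ → Ω → 𝒳} {N : ℕ} {mA : ℕ → ℕ} {A : (k : ℕ) → Fin (mA k) → Set 𝒳}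
  {w : (k : ℕ) → ℕ → Ω → Fin (mA k) → ℝ} {f : 𝒳 → ℝ} {g : ι → 𝒳 → ℝ}

omit [MeasurableSpace 𝒳] in
lemma raked_zero (p : (k : ℕ) → Fin (mA k) → ℝ) (x : ℕ → 𝒳) (n : ℕ) :
    raked A p x n 0 = empirical x n :=
  rfl

omit [MeasurableSpace 𝒳] in
lemma raked_succ (p : (k : ℕ) → Fin (mA k) → ℝ) (x : ℕ → 𝒳) (n N : ℕ) :
    raked A p x n (N + 1) = rake (A (N + 1)) (p (N + 1)) (raked A p x n N) :=
  rfl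

omit [MeasurableSpace 𝒳] in
lemma isLinearMap_raked (p : (k : ℕ) → Fin (mA k) → ℝ) (x : ℕ → 𝒳) (n N : ℕ) :
    IsLinearMap ℝ (raked A p x n N) := by
  induction N with
  | zero => exact isLinearMap_empirical x n
  | succ N ih => exact isLinearMap_rake ih

lemma aemeasurable_raked (hX : ∀ i, AEMeasurable (X i) μ) {n : ℕ}
    (hA : ∀ k ∈ Set.Icc 1 N, ∀ j, MeasurableSet (A k j))
    (hw : ∀ k ∈ Set.Icc 1 N, ∀ j, AEMeasurable (fun ω => w k n ω j) μ) (hf : Measurable f) :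
    AEMeasurable (fun ω => raked A (fun k => w k n ω) (fun i => X i ω) n N f) μ := by
  induction N generalizing f with
  | zero => exact aemeasurable_empirical hX hf n
  | succ N ih =>
    obtain ⟨hAN, hA'⟩ := forall_mem_Icc_one_succ.1 hA
    obtain ⟨hwN, hw'⟩ := forall_mem_Icc_one_succ.1 hw
    exact Finset.aemeasurable_fun_sum _ fun j _ =>
      ((hw' j).div (ih hAN hwN (measurable_one.indicator (hA' j)))).mul
        (ih hAN hwN (hf.indicator (hA' j)))

lemma aemeasurable_fluctuationVec_raked [Finite ι] (hX : ∀ i, AEMeasurable (X i) μ)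
    (hA : ∀ k ∈ Set.Icc 1 N, ∀ j, MeasurableSet (A k j))
    (hw : ∀ k ∈ Set.Icc 1 N, ∀ j, ∀ n, 1 ≤ n → AEMeasurable (fun ω => w k n ω j) μ)
    (hg : ∀ i, Measurable (g i)) (n : ℕ) :
    AEMeasurable
      (fun ω => fluctuationVec P n (raked A (fun k => w k n ω) (fun i => X i ω) n N) g) μ := by
  refine (WithLp.measurable_toLp 2 _).comp_aemeasurable (aemeasurable_pi_lambda _ fun i => ?_)
  rcases n.eq_zero_or_pos with rfl | hn
  · simp [fluctuation]
  · exact ((aemeasurable_raked hX hA (fun k hk j => hw k hk j n hn) (hg i)).sub_const _).const_mul _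

theorem ae_tendsto_raked [IsFiniteMeasure P] (hX_indep : iIndepFun X μ)
    (hX_law : ∀ i, HasLaw (X i) P μ) (hA : ∀ k ∈ Set.Icc 1 N, IsMeasurablePartition (A k))
    (hA_pos : ∀ k ∈ Set.Icc 1 N, ∀ j, 0 < P.real (A k j))
    (hw : ∀ k ∈ Set.Icc 1 N, ∀ j,
      ∀ᵐ ω ∂μ, Tendsto (fun n => w k n ω j) atTop (𝓝 (P.real (A k j))))
    (hf : Measurable f) (hfP : Integrable f P) :
    ∀ᵐ ω ∂μ, Tendsto (fun n => raked A (fun k => w k n ω) (fun i => X i ω) n N f) atTop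
      (𝓝 (∫ x, f x ∂P)) := by
  induction N generalizing f with
  | zero => exact ae_tendsto_empirical hX_indep hX_law hf hfP
  | succ N ih =>
    obtain ⟨hAN, hA'⟩ := forall_mem_Icc_one_succ.1 hA
    obtain ⟨hposN, hpos'⟩ := forall_mem_Icc_one_succ.1 hA_pos
    obtain ⟨hwN, hw'⟩ := forall_mem_Icc_one_succ.1 hw
    have hind (j) {h : 𝒳 → ℝ} (hh : Measurable h) (hhP : Integrable h P) :=
      ih hAN hposN hwN (hh.indicator (hA'.measurableSet j)) (hhP.indicator (hA'.measurableSet j))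
    filter_upwards [ae_all_iff.2 hw', ae_all_iff.2 fun j => hind j hf hfP,
      ae_all_iff.2 fun j => hind j measurable_one (integrable_const 1)] with ω hwω hfω honeω
    refine tendsto_rake hA' (fun j => (hpos' j).ne') hfP hwω (fun j => ?_) fun j => ?_
    · rw [← integral_indicator_one (hA'.measurableSet j)]
      exact honeω j
    · rw [← integral_indicator (hA'.measurableSet j)]
      exact hfω j

variable [IsProbabilityMeasure μ]

lemma isTightAlong_fluctuation_empirical (hX_indep : iIndepFun X μ)
    (hX_law : ∀ i, HasLaw (X i) P μ) (hf : Measurable f) (hfP : MemLp f 2 P) :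
    IsTightAlong (inProbability μ atTop) fun z : ℕ × Ω =>
      fluctuation P z.1 (empirical (fun i => X i z.2) z.1) f :=
  fun _ hc => tendsto_smul_zero_of_tendstoInDistribution
    (tendstoInDistribution_fluctuation_empirical hX_indep hX_law hf hfP
      (Z := id) ⟨aemeasurable_id, Measure.map_id⟩) hc

theorem tendsto_fluctuation_raked_sub (hX_indep : iIndepFun X μ) (hX_law : ∀ i, HasLaw (X i) P μ)
    (hA : ∀ k ∈ Set.Icc 1 N, IsMeasurablePartition (A k))
    (hA_pos : ∀ k ∈ Set.Icc 1 N, ∀ j, 0 < P.real (A k j))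
    (hw : ∀ k ∈ Set.Icc 1 N, ∀ j, Tendsto
      (fun z : ℕ × Ω => √z.1 * (w k z.1 z.2 j - P.real (A k j))) (inProbability μ atTop) (𝓝 0))
    (hf : Measurable f) (hfP : MemLp f 2 P) :
    Tendsto (fun z : ℕ × Ω =>
      fluctuation P z.1 (raked A (fun k => w k z.1 z.2) (fun i => X i z.2) z.1 N) f -
        fluctuation P z.1 (empirical (fun i => X i z.2) z.1) (iterCentered P A N f))
      (inProbability μ atTop) (𝓝 0) := by
  have : IsProbabilityMeasure P := (hX_law 0).isProbabilityMeasure_iff.1 ‹_›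
  induction N generalizing f with
  | zero => simp only [raked_zero, iterCentered, sub_self, tendsto_const_nhds]
  | succ N ih =>
    obtain ⟨hAN, hA'⟩ := forall_mem_Icc_one_succ.1 hA
    obtain ⟨hposN, hpos'⟩ := forall_mem_Icc_one_succ.1 hA_pos
    obtain ⟨hwN, hw'⟩ := forall_mem_Icc_one_succ.1 hw
    have hAm : ∀ k ∈ Set.Icc 1 N, ∀ j, MeasurableSet (A k j) := fun k hk => (hAN k hk).measurableSet
    have htight (j) {h : 𝒳 → ℝ} (hh : Measurable h) (hhP : MemLp h 2 P) :
        IsTightAlong (inProbability μ atTop) fun z : ℕ × Ω => fluctuation P z.1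
          (raked A (fun k => w k z.1 z.2) (fun i => X i z.2) z.1 N)
          ((A (N + 1) j).indicator h) := by
      have hm := hh.indicator (hA'.measurableSet j)
      have hL2 := hhP.indicator (hA'.measurableSet j)
      simpa only [sub_add_cancel] using (IsTightAlong.of_tendsto (ih hAN hposN hwN hm hL2)).add
        (isTightAlong_fluctuation_empirical hX_indep hX_law (measurable_iterCentered hAm hm)
          (memLp_iterCentered hAm hL2))
    have hstep := tendsto_fluctuation_rake_sub tendsto_fst_inProbability hA'
      (fun j => (hpos' j).ne') (hfP.integrable one_le_two) hw' (fun z => isLinearMap_raked _ _ _ _)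
      (fun j => htight j measurable_one (memLp_const 1))
      fun j => htight j (hf.sub_const _) (hfP.sub (memLp_const _))
    have hprev := ih hAN hposN hwN (measurable_condCentered hA'.measurableSet hf)
      (memLp_condCentered hA'.measurableSet hfP)
    simpa only [raked_succ, iterCentered, sub_add_sub_cancel, add_zero] using hstep.add hprev

theorem tendstoInDistribution_fluctuationVec_raked [Fintype ι] [DecidableEq ι]
    (hX_indep : iIndepFun X μ) (hX_law : ∀ i, HasLaw (X i) P μ)
    (hA : ∀ k ∈ Set.Icc 1 N, IsMeasurablePartition (A k))
    (hA_pos : ∀ k ∈ Set.Icc 1 N, ∀ j, 0 < P.real (A k j))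
    (hw_meas : ∀ k ∈ Set.Icc 1 N, ∀ j, ∀ n, 1 ≤ n → AEMeasurable (fun ω => w k n ω j) μ)
    (hw : ∀ k ∈ Set.Icc 1 N, ∀ j, Tendsto
      (fun z : ℕ × Ω => √z.1 * (w k z.1 z.2 j - P.real (A k j))) (inProbability μ atTop) (𝓝 0))
    (hg : ∀ i, Measurable (g i)) (hgP : ∀ i, MemLp (g i) 2 P) :
    TendstoInDistribution
      (fun n ω => fluctuationVec P n (raked A (fun k => w k n ω) (fun i => X i ω) n N) g) atTop id
      (fun _ => μ) (multivariateGaussian 0 (covMatrix P fun i => iterCentered P A N (g i))) := by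
  have : IsProbabilityMeasure P := (hX_law 0).isProbabilityMeasure_iff.1 ‹_›
  have hAm : ∀ k ∈ Set.Icc 1 N, ∀ j, MeasurableSet (A k j) := fun k hk => (hA k hk).measurableSet
  refine tendstoInDistribution_of_tendstoInMeasure_sub _ _
    (tendstoInDistribution_fluctuationVec_empirical hX_indep hX_law
      (fun i => measurable_iterCentered hAm (hg i)) fun i => memLp_iterCentered hAm (hgP i))
    (tendstoInMeasure_const_iff.2 ?_) fun n => ?_
  · refine ((PiLp.continuous_toLp 2 _).tendsto 0).comp (tendsto_pi_nhds.2 fun i => ?_)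
    exact tendsto_fluctuation_raked_sub hX_indep hX_law hA hA_pos hw (hg i) (hgP i)
  · exact aemeasurable_fluctuationVec_raked (fun i => (hX_law i).aemeasurable) hAm hw_meas hg n

end Raked

section Hoeffding

variable {ι 𝒳 : Type*} [Fintype ι] [MeasurableSpace 𝒳] {ν : Measure 𝒳} [IsProbabilityMeasure ν]
  {f : 𝒳 → ℝ} {a b t : ℝ}

lemma pi_real_le_sum_sub_integral_le (hf : Measurable f) (hfab : ∀ x, f x ∈ Set.Icc a b)
    (ht : 0 ≤ t) :
    (Measure.pi fun _ : ι => ν).real {y | t ≤ ∑ i, (f (y i) - ∫ x, f x ∂ν)} ≤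
      Real.exp (-2 * t ^ 2 / (Fintype.card ι * (b - a) ^ 2)) := by
  have hsub (i : ι) : HasSubgaussianMGF (fun y : ι → 𝒳 => f (y i) - ∫ x, f x ∂ν)
      ((‖b - a‖₊ / 2) ^ 2) (Measure.pi fun _ => ν) := by
    have heval := measurePreserving_eval (fun _ : ι => ν) i
    refine .of_map (X := fun x => f x - ∫ x, f x ∂ν) heval.measurable.aemeasurable ?_
    rw [heval.map_eq]
    exact hasSubgaussianMGF_of_mem_Icc hf.aemeasurable (ae_of_all _ hfab)
  have hindep : iIndepFun (fun i (y : ι → 𝒳) => f (y i) - ∫ x, f x ∂ν)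
      (Measure.pi fun _ => ν) :=
    iIndepFun_pi (X := fun _ x => f x - ∫ x, f x ∂ν) fun _ => (hf.sub_const _).aemeasurable
  refine (HasSubgaussianMGF.measure_sum_ge_le_of_iIndepFun hindep (s := Finset.univ)
    (fun i _ => hsub i) ht).trans_eq ?_
  have hconst : ((∑ _i : ι, (‖b - a‖₊ / 2) ^ 2 : NNReal) : ℝ) =
      Fintype.card ι * (b - a) ^ 2 / 4 := by
    simp [div_pow]
    ring
  rw [hconst]
  congr 1
  field_simp
  ring

theorem pi_real_le_abs_sum_sub_integral_le (hf : Measurable f) (hfab : ∀ x, f x ∈ Set.Icc a b)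
    (ht : 0 ≤ t) :
    (Measure.pi fun _ : ι => ν).real {y | t ≤ |∑ i, (f (y i) - ∫ x, f x ∂ν)|} ≤
      2 * Real.exp (-2 * t ^ 2 / (Fintype.card ι * (b - a) ^ 2)) := by
  have hupper := pi_real_le_sum_sub_integral_le (ι := ι) (ν := ν) hf hfab ht
  have hlower := pi_real_le_sum_sub_integral_le (ι := ι) (ν := ν) hf.neg (a := -b) (b := -a)
    (fun x => ⟨neg_le_neg (hfab x).2, neg_le_neg (hfab x).1⟩) ht
  rw [neg_sub_neg] at hlower
  rw [two_mul]
  refine ((measureReal_mono fun y hy => ?_).trans (measureReal_union_le _ _)).trans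
    (add_le_add hupper hlower)
  refine (le_abs.1 (Set.mem_ofPred_eq ▸ hy)).imp id fun h => ?_
  simpa only [Set.mem_ofPred_eq, Pi.neg_apply, integral_neg, ← neg_sub', Finset.sum_neg_distrib]
    using h

end Hoeffding

section Rates

lemma tendsto_div_atTop_of_isLittleO {κ : Type*} {l : Filter κ} {f g : κ → ℝ} (h : f =o[l] g)
    (hf : ∀ᶠ z in l, 0 < f z) (hg : ∀ z, 0 ≤ g z) : Tendsto (fun z => g z / f z) l atTop := by
  refine tendsto_atTop.2 fun C => ?_
  obtain ⟨K, hK⟩ := exists_nat_ge C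
  filter_upwards [isLittleO_iff_nat_mul_le.1 h K, hf] with z hz hfz
  rw [Real.norm_of_nonneg hfz.le, Real.norm_of_nonneg (hg z)] at hz
  exact hK.trans ((le_div_iff₀ hfz).2 hz)

lemma summable_exp_neg_mul_of_log_isLittleO {c : ℝ} (hc : 0 < c) {s : ℕ → ℝ}
    (hs : ∀ n, 0 ≤ s n) (hlog : (fun n : ℕ => Real.log n) =o[atTop] s) :
    Summable fun n => Real.exp (-c * s n) := by
  refine summable_of_isBigO_nat (Real.summable_nat_pow_inv.2 one_lt_two) (.of_bound 1 ?_)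
  filter_upwards [hlog.bound (half_pos hc), eventually_gt_atTop 0] with n hn hn0
  have hn' : (0 : ℝ) < n := by exact_mod_cast hn0
  rw [Real.norm_of_nonneg (hs n)] at hn
  rw [Real.norm_of_nonneg (Real.exp_pos _).le, Real.norm_of_nonneg (by positivity), one_mul,
    ← Real.exp_log (by positivity : (0 : ℝ) < ((n : ℝ) ^ 2)⁻¹), Real.exp_le_exp, Real.log_inv,
    Real.log_pow]
  push_cast
  linarith [Real.le_norm_self (Real.log n)]

end Rates

section Multinomial

variable {m : ℕ} {p : Fin m → ℝ}

lemma isProbabilityMeasure_categorical (hp : ∀ j, 0 ≤ p j) (hsum : ∑ j, p j = 1) :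
    IsProbabilityMeasure (categorical p) where
  measure_univ := by
    simp only [categorical, Measure.coe_finsetSum, Finset.sum_apply, Measure.smul_apply,
      measure_univ, smul_eq_mul, mul_one]
    rw [← ENNReal.ofReal_sum_of_nonneg fun j _ => hp j, hsum, ENNReal.ofReal_one]

lemma categorical_real_singleton {j : Fin m} (hj : 0 ≤ p j) :
    (categorical p).real {j} = p j := by
  simp [categorical, measureReal_def, Set.indicator_apply, hj]

lemma multinomialFreq_eq_map (n : ℕ) (p : Fin m → ℝ) :
    multinomialFreq n p = (Measure.pi fun _ : Fin n => categorical p).map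
      fun y j => (∑ i, ({j} : Set (Fin m)).indicator (1 : Fin m → ℝ) (y i)) / n := by
  rw [multinomialFreq, multinomial, Measure.map_map (by fun_prop) .of_discrete]
  congr 1
  ext y j
  simp [Set.indicator_apply]

theorem multinomialFreq_real_le_abs_sub_le (hp : ∀ j, 0 ≤ p j) (hsum : ∑ j, p j = 1) (n : ℕ)
    (j : Fin m) {ε : ℝ} (hε : 0 ≤ ε) :
    (multinomialFreq n p).real {v | ε ≤ |v j - p j|} ≤ 2 * Real.exp (-2 * n * ε ^ 2) := by
  have := isProbabilityMeasure_categorical hp hsum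
  set f : Fin m → ℝ := ({j} : Set (Fin m)).indicator 1 with hf
  have hmean : ∫ y, f y ∂categorical p = p j :=
    (integral_indicator_one (measurableSet_singleton j)).trans (categorical_real_singleton (hp j))
  have hmem (y : Fin m) : f y ∈ Set.Icc (0 : ℝ) 1 := by
    by_cases hy : y = j <;> simp [hf, hy]
  have hbound := pi_real_le_abs_sum_sub_integral_le (ι := Fin n) (ν := categorical p)
    .of_discrete hmem (t := n * ε) (by positivity)
  rw [multinomialFreq_eq_map, map_measureReal_apply .of_discrete
    (measurableSet_le measurable_const (by fun_prop))]
  refine (measureReal_mono fun y hy => ?_).trans (hbound.trans_eq ?_)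
  · have hscale : ∑ i, (f (y i) - p j) = n * ((∑ i, f (y i)) / n - p j) := by
      rcases n.eq_zero_or_pos with rfl | hn
      · simp
      · simp only [Finset.sum_sub_distrib, Finset.sum_const, Finset.card_univ, Fintype.card_fin,
          nsmul_eq_mul]
        field_simp
    rw [Set.mem_ofPred_eq, hmean, hscale, abs_mul, Nat.abs_cast]
    exact mul_le_mul_of_nonneg_left hy n.cast_nonneg
  · rw [Fintype.card_fin]
    congr 2
    field_simp
    ring

variable {Ω : Type*} [MeasurableSpace Ω] {μ : Measure Ω} {size : ℕ → ℕ} {W : ℕ → Ω → Fin m → ℝ}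

lemma measureReal_le_dist_of_hasLaw_multinomialFreq (hp : ∀ j, 0 ≤ p j) (hsum : ∑ j, p j = 1)
    {n : ℕ} {V : Ω → Fin m → ℝ} (hV : HasLaw V (multinomialFreq n p) μ) (j : Fin m) {ε : ℝ}
    (hε : 0 ≤ ε) : μ.real {ω | ε ≤ dist (V ω j) (p j)} ≤ 2 * Real.exp (-2 * n * ε ^ 2) :=
  (hV.measureReal_eq (p := fun v => ε ≤ |v j - p j|)
    (measurableSet_le measurable_const (by fun_prop))).trans_le
    (multinomialFreq_real_le_abs_sub_le hp hsum n j hε)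

variable [IsFiniteMeasure μ]

theorem tendsto_sqrt_mul_sub_of_hasLaw_multinomialFreq (hp : ∀ j, 0 ≤ p j) (hsum : ∑ j, p j = 1)
    (hW : ∀ n, 1 ≤ n → HasLaw (W n) (multinomialFreq (size n) p) μ)
    (hsize : (fun n : ℕ => (n : ℝ)) =o[atTop] fun n => (size n : ℝ)) (j : Fin m) :
    Tendsto (fun z : ℕ × Ω => √z.1 * (W z.1 z.2 j - p j)) (inProbability μ atTop) (𝓝 0) := by
  refine (tendstoInMeasure_const_iff (Y := fun (n : ℕ) ω => √n * (W n ω j - p j))).1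
    (tendstoInMeasure_iff_measureReal_dist.2 fun ε hε => ?_)
  have hratio : Tendsto (fun n : ℕ => (size n / n : ℝ)) atTop atTop :=
    tendsto_div_atTop_of_isLittleO hsize
      ((eventually_gt_atTop 0).mono fun n hn => Nat.cast_pos.2 hn) fun n => (size n).cast_nonneg
  have hexp := (Real.tendsto_exp_neg_atTop_nhds_zero.comp
    (hratio.const_mul_atTop (by positivity : 0 < 2 * ε ^ 2))).const_mul 2
  rw [mul_zero] at hexp
  refine squeeze_zero' (.of_forall fun n => measureReal_nonneg) ?_ hexp
  filter_upwards [eventually_ge_atTop 1] with n hn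
  have hn' : (0 : ℝ) < n := by exact_mod_cast hn
  have hset : {ω | ε ≤ dist (√n * (W n ω j - p j)) 0} = {ω | ε / √n ≤ dist (W n ω j) (p j)} := by
    ext ω
    rw [Set.mem_ofPred_eq, Set.mem_ofPred_eq, Real.dist_0_eq_abs, abs_mul,
      abs_of_pos (Real.sqrt_pos.2 hn'), div_le_iff₀' (Real.sqrt_pos.2 hn'), Real.dist_eq]
  rw [hset]
  refine (measureReal_le_dist_of_hasLaw_multinomialFreq hp hsum (hW n hn) j
    (by positivity)).trans_eq ?_
  rw [div_pow, Real.sq_sqrt hn'.le]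
  simp only [Function.comp_apply]
  congr 2
  ring

-- Hoeffding's bound is summable, so that the Borel-Cantelli lemma needs no independence.
theorem ae_tendsto_of_hasLaw_multinomialFreq (hp : ∀ j, 0 ≤ p j) (hsum : ∑ j, p j = 1)
    (hW : ∀ n, 1 ≤ n → HasLaw (W n) (multinomialFreq (size n) p) μ)
    (hsize : (fun n : ℕ => Real.log n) =o[atTop] fun n => (size n : ℝ)) (j : Fin m) :
    ∀ᵐ ω ∂μ, Tendsto (fun n => W n ω j) atTop (𝓝 (p j)) := by
  refine ae_tendsto_of_summable_measureReal_le_dist fun ε hε => ?_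
  have hsummable := (summable_exp_neg_mul_of_log_isLittleO (by positivity : 0 < 2 * ε ^ 2)
    (fun n => (size n).cast_nonneg) hsize).mul_left 2
  refine .of_norm_bounded_eventually_nat hsummable ?_
  filter_upwards [eventually_ge_atTop 1] with n hn
  rw [Real.norm_of_nonneg measureReal_nonneg]
  refine (measureReal_le_dist_of_hasLaw_multinomialFreq hp hsum (hW n hn) j hε.le).trans_eq ?_
  congr 2
  ring

end Multinomial

section CellScore

variable {𝒳 : Type*} [MeasurableSpace 𝒳] {P P₀ : Measure 𝒳} {m : ℕ} {B : Fin m → Set 𝒳}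

/-- The normalized indicators `1_{B i} / √P(B i)`: when `P` and `P₀` agree on the cells, the
chi-square statistic is the squared norm of the vector of their fluctuations. -/
def cellScore (P : Measure 𝒳) (B : Fin m → Set 𝒳) (i : Fin m) : 𝒳 → ℝ :=
  (√(P.real (B i)))⁻¹ • (B i).indicator 1

lemma measurable_cellScore (hB : ∀ i, MeasurableSet (B i)) (i : Fin m) :
    Measurable (cellScore P B i) :=
  (measurable_one.indicator (hB i)).const_smul _

lemma memLp_cellScore [IsFiniteMeasure P] (hB : ∀ i, MeasurableSet (B i)) (p : ENNReal)
    (i : Fin m) : MemLp (cellScore P B i) p P :=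
  have hone : MemLp ((B i).indicator (1 : 𝒳 → ℝ)) p P := (memLp_const (1 : ℝ)).indicator (hB i)
  hone.const_smul _

lemma norm_fluctuationVec_cellScore_sq (hB : ∀ i, MeasurableSet (B i))
    (hPP₀ : ∀ i, P.real (B i) = P₀.real (B i)) {Q : (𝒳 → ℝ) → ℝ} (hQ : IsLinearMap ℝ Q) (n : ℕ) :
    ‖fluctuationVec P n Q (cellScore P B)‖ ^ 2 = chiStat B P₀ n Q := by
  rw [EuclideanSpace.real_norm_sq_eq, chiStat, Finset.mul_sum]
  refine Finset.sum_congr rfl fun i _ => ?_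
  have hscore : fluctuation P n Q (cellScore P B i) =
      (√(P.real (B i)))⁻¹ * (√n * (Q ((B i).indicator 1) - P.real (B i))) := by
    simp only [fluctuation, cellScore, hQ.map_smul, Pi.smul_apply, smul_eq_mul,
      integral_const_mul, integral_indicator_one (hB i)]
    ring
  change fluctuation P n Q (cellScore P B i) ^ 2 = _
  rw [hscore, hPP₀, mul_pow, mul_pow, inv_pow, Real.sq_sqrt measureReal_nonneg,
    Real.sq_sqrt n.cast_nonneg]
  ring

lemma sum_smul_cellScore_apply (hB : IsMeasurablePartition B) (t : Fin m → ℝ) {i : Fin m} {x : 𝒳}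
    (hx : x ∈ B i) : (∑ j, t j * cellScore P B j x) = t i * (√(P.real (B i)))⁻¹ := by
  rw [Finset.sum_eq_single i _ (by simp)]
  · simp [cellScore, hx]
  · intro j _ hji
    simp [cellScore, Set.disjoint_right.1 (hB.pairwise_disjoint hji) hx]

theorem dotProduct_covMatrix_cellScore_mulVec [IsProbabilityMeasure P]
    (hB : IsMeasurablePartition B) (hB_pos : ∀ i, 0 < P.real (B i))
    (t : EuclideanSpace ℝ (Fin m)) :
    t.ofLp ⬝ᵥ (covMatrix P (cellScore P B)).mulVec t.ofLp =
      ‖t‖ ^ 2 - inner ℝ (WithLp.toLp 2 fun i => √(P.real (B i))) t ^ 2 := by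
  have hL2 : MemLp (fun x => ∑ i, t i * cellScore P B i x) 2 P :=
    memLp_finsetSum _ fun i _ => (memLp_cellScore hB.measurableSet 2 i).const_mul _
  have hmean : ∫ x, ∑ i, t i * cellScore P B i x ∂P =
      inner ℝ (WithLp.toLp 2 fun i => √(P.real (B i))) t := by
    rw [hB.integral_eq_sum (hL2.integrable one_le_two), PiLp.inner_apply]
    refine Finset.sum_congr rfl fun i _ => ?_
    rw [setIntegral_congr_fun (hB.measurableSet i) fun x hx => sum_smul_cellScore_apply hB t hx,
      setIntegral_const, smul_eq_mul, mul_left_comm, ← div_eq_mul_inv, Real.div_sqrt]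
    rfl
  have hsecond : ∫ x, (∑ i, t i * cellScore P B i x) ^ 2 ∂P = ‖t‖ ^ 2 := by
    rw [hB.integral_eq_sum hL2.integrable_sq, EuclideanSpace.real_norm_sq_eq]
    refine Finset.sum_congr rfl fun i _ => ?_
    rw [setIntegral_congr_fun (hB.measurableSet i) fun x hx =>
      congrArg (· ^ 2) (sum_smul_cellScore_apply hB t hx), setIntegral_const, smul_eq_mul,
      mul_pow, inv_pow, Real.sq_sqrt (hB_pos i).le, mul_left_comm,
      mul_inv_cancel₀ (hB_pos i).ne', mul_one]
  rw [dotProduct_covMatrix_mulVec (memLp_cellScore hB.measurableSet 2), variance_eq_sub hL2]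
  simp only [Pi.pow_apply]
  rw [hsecond, hmean]

lemma norm_toLp_sqrt_measureReal [IsProbabilityMeasure P] (hB : IsMeasurablePartition B) :
    ‖(WithLp.toLp 2 fun i => √(P.real (B i)) : EuclideanSpace ℝ (Fin m))‖ = 1 := by
  simp only [EuclideanSpace.norm_eq, Real.norm_eq_abs, sq_abs, Real.sq_sqrt measureReal_nonneg,
    hB.sum_measureReal, Real.sqrt_one]

theorem map_norm_sq_multivariateGaussian_cellScore [IsProbabilityMeasure P] (hm : 1 ≤ m)
    (hB : IsMeasurablePartition B) (hB_pos : ∀ i, 0 < P.real (B i)) :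
    (multivariateGaussian 0 (covMatrix P (cellScore P B))).map (fun x => ‖x‖ ^ 2) =
      chiSquare (m - 1) := by
  rw [map_norm_sq_multivariateGaussian_zero
    (posSemidef_covMatrix (memLp_cellScore hB.measurableSet 2))]
  simp_rw [dotProduct_covMatrix_cellScore_mulVec hB hB_pos]
  exact map_norm_sq_sub_inner_sq_stdGaussian (by simp; omega) (norm_toLp_sqrt_measureReal hB)

theorem multivariateGaussian_cellScore_real_critical_lt [IsProbabilityMeasure P] (hm : 2 ≤ m)
    (hB : IsMeasurablePartition B) (hB_pos : ∀ i, 0 < P.real (B i)) {α : ℝ} (hα0 : 0 < α)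
    (hα1 : α < 1) :
    (multivariateGaussian 0 (covMatrix P (cellScore P B))).real {x | critical m α < ‖x‖ ^ 2} =
      α := by
  have htail := chiSquare_Ioi_critical hm hα0 hα1
  rwa [← map_norm_sq_multivariateGaussian_cellScore (by omega) hB hB_pos,
    map_measureReal_apply (by fun_prop) measurableSet_Ioi] at htail

theorem multivariateGaussian_iterCentered_cellScore_real_critical_lt_le [IsProbabilityMeasure P]
    {N : ℕ} {mA : ℕ → ℕ} {A : (k : ℕ) → Fin (mA k) → Set 𝒳}
    (hA : ∀ k ∈ Set.Icc 1 N, IsMeasurablePartition (A k)) (hm : 2 ≤ m)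
    (hB : IsMeasurablePartition B) (hB_pos : ∀ i, 0 < P.real (B i)) {α : ℝ} (hα0 : 0 < α)
    (hα1 : α < 1) :
    (multivariateGaussian 0 (covMatrix P fun i => iterCentered P A N (cellScore P B i))).real
      {x | critical m α < ‖x‖ ^ 2} ≤ α := by
  have hL2 := memLp_cellScore (P := P) hB.measurableSet 2
  refine (multivariateGaussian_zero_real_lt_norm_sq_mono
    (posSemidef_covMatrix fun i => memLp_iterCentered (fun k hk => (hA k hk).measurableSet) (hL2 i))
    (posSemidef_covMatrix hL2) (dotProduct_covMatrix_iterCentered_mulVec_le hA hL2) _).trans_eq ?_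
  exact multivariateGaussian_cellScore_real_critical_lt hm hB hB_pos hα0 hα1

end CellScore

section ChiStat

variable {𝒳 : Type*} [MeasurableSpace 𝒳] {P₀ : Measure 𝒳} {m : ℕ} {B : Fin m → Set 𝒳}

theorem eventually_lt_abs_chiStat (hB_pos : ∀ i, 0 < P₀.real (B i)) {Q : ℕ → (𝒳 → ℝ) → ℝ}
    {i : Fin m} {q : ℝ} (hq : q ≠ P₀.real (B i))
    (hQ : Tendsto (fun n => Q n ((B i).indicator 1)) atTop (𝓝 q)) (c : ℝ) :
    ∀ᶠ n in atTop, c < |chiStat B P₀ n (Q n)| := by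
  have hpos : 0 < (q - P₀.real (B i)) ^ 2 / P₀.real (B i) :=
    div_pos (sq_pos_of_ne_zero (sub_ne_zero.2 hq)) (hB_pos i)
  have htop := tendsto_natCast_atTop_atTop.atTop_mul_pos hpos
    (((hQ.sub_const (P₀.real (B i))).pow 2).div_const (P₀.real (B i)))
  filter_upwards [htop.eventually_gt_atTop c] with n hn
  refine (hn.trans_le ?_).trans_le (le_abs_self _)
  exact mul_le_mul_of_nonneg_left (Finset.single_le_sum
    (f := fun i => (Q n ((B i).indicator 1) - P₀.real (B i)) ^ 2 / P₀.real (B i))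
    (fun j _ => div_nonneg (sq_nonneg _) measureReal_nonneg) (Finset.mem_univ i)) n.cast_nonneg

variable {Ω : Type*} [MeasurableSpace Ω] {μ : Measure Ω} [IsProbabilityMeasure μ]
  {P : Measure 𝒳} {X : ℕ → Ω → 𝒳}

theorem tendsto_measureReal_lt_stat (hX_indep : iIndepFun X μ) (hX_law : ∀ i, HasLaw (X i) P μ)
    (hB : ∀ i, MeasurableSet (B i)) (hPP₀ : ∀ i, P.real (B i) = P₀.real (B i)) {c : ℝ}
    (hc : 0 < c) :
    Tendsto (fun n => μ.real {ω | c < stat B P₀ X n ω}) atTop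
      (𝓝 ((multivariateGaussian 0 (covMatrix P (cellScore P B))).real {x | c < ‖x‖ ^ 2})) := by
  have : IsProbabilityMeasure P := (hX_law 0).isProbabilityMeasure_iff.1 ‹_›
  have hclt := tendsto_measureReal_lt_norm_sq (tendstoInDistribution_fluctuationVec_empirical
    hX_indep hX_law (measurable_cellScore hB) (memLp_cellScore hB 2)) hc
  simpa only [stat, norm_fluctuationVec_cellScore_sq hB hPP₀ (isLinearMap_empirical _ _)]
    using hclt

theorem tendsto_measureReal_lt_chiStat_raked {N : ℕ} {mA : ℕ → ℕ}
    {A : (k : ℕ) → Fin (mA k) → Set 𝒳} {w : (k : ℕ) → ℕ → Ω → Fin (mA k) → ℝ}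
    (hX_indep : iIndepFun X μ) (hX_law : ∀ i, HasLaw (X i) P μ)
    (hA : ∀ k ∈ Set.Icc 1 N, IsMeasurablePartition (A k))
    (hA_pos : ∀ k ∈ Set.Icc 1 N, ∀ j, 0 < P.real (A k j))
    (hw_meas : ∀ k ∈ Set.Icc 1 N, ∀ j, ∀ n, 1 ≤ n → AEMeasurable (fun ω => w k n ω j) μ)
    (hw : ∀ k ∈ Set.Icc 1 N, ∀ j, Tendsto
      (fun z : ℕ × Ω => √z.1 * (w k z.1 z.2 j - P.real (A k j))) (inProbability μ atTop) (𝓝 0))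
    (hB : ∀ i, MeasurableSet (B i)) (hPP₀ : ∀ i, P.real (B i) = P₀.real (B i)) {c : ℝ}
    (hc : 0 < c) :
    Tendsto (fun n => μ.real {ω | c < chiStat B P₀ n
        (raked A (fun k => w k n ω) (fun i => X i ω) n N)}) atTop
      (𝓝 ((multivariateGaussian 0
        (covMatrix P fun i => iterCentered P A N (cellScore P B i))).real {x | c < ‖x‖ ^ 2})) := by
  have : IsProbabilityMeasure P := (hX_law 0).isProbabilityMeasure_iff.1 ‹_›
  have hclt := tendsto_measureReal_lt_norm_sq (tendstoInDistribution_fluctuationVec_raked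
    hX_indep hX_law hA hA_pos hw_meas hw (measurable_cellScore hB) (memLp_cellScore hB 2)) hc
  simpa only [norm_fluctuationVec_cellScore_sq hB hPP₀ (isLinearMap_raked _ _ _ _)] using hclt

theorem ae_eventually_lt_abs_stat (hX_indep : iIndepFun X μ) (hX_law : ∀ i, HasLaw (X i) P μ)
    (hB : ∀ i, MeasurableSet (B i)) (hB_pos : ∀ i, 0 < P₀.real (B i)) {i : Fin m}
    (hi : P.real (B i) ≠ P₀.real (B i)) (c : ℝ) :
    ∀ᵐ ω ∂μ, ∀ᶠ n in atTop, c < |stat B P₀ X n ω| := by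
  have : IsProbabilityMeasure P := (hX_law 0).isProbabilityMeasure_iff.1 ‹_›
  rw [← integral_indicator_one (hB i)] at hi
  filter_upwards [ae_tendsto_empirical hX_indep hX_law (measurable_one.indicator (hB i))
    ((integrable_const 1).indicator (hB i))] with ω hω
  exact eventually_lt_abs_chiStat hB_pos hi hω c

theorem ae_eventually_lt_abs_chiStat_raked {N : ℕ} {mA : ℕ → ℕ}
    {A : (k : ℕ) → Fin (mA k) → Set 𝒳} {w : (k : ℕ) → ℕ → Ω → Fin (mA k) → ℝ}
    (hX_indep : iIndepFun X μ) (hX_law : ∀ i, HasLaw (X i) P μ)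
    (hA : ∀ k ∈ Set.Icc 1 N, IsMeasurablePartition (A k))
    (hA_pos : ∀ k ∈ Set.Icc 1 N, ∀ j, 0 < P.real (A k j))
    (hw : ∀ k ∈ Set.Icc 1 N, ∀ j,
      ∀ᵐ ω ∂μ, Tendsto (fun n => w k n ω j) atTop (𝓝 (P.real (A k j))))
    (hB : ∀ i, MeasurableSet (B i)) (hB_pos : ∀ i, 0 < P₀.real (B i)) {i : Fin m}
    (hi : P.real (B i) ≠ P₀.real (B i)) (c : ℝ) :
    ∀ᵐ ω ∂μ, ∀ᶠ n in atTop,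
      c < |chiStat B P₀ n (raked A (fun k => w k n ω) (fun i => X i ω) n N)| := by
  have : IsProbabilityMeasure P := (hX_law 0).isProbabilityMeasure_iff.1 ‹_›
  rw [← integral_indicator_one (hB i)] at hi
  filter_upwards [ae_tendsto_raked hX_indep hX_law hA hA_pos hw
    (measurable_one.indicator (hB i)) ((integrable_const 1).indicator (hB i))] with ω hω
  exact eventually_lt_abs_chiStat hB_pos hi hω c

end ChiStat

section SampleSize

lemma log_isLittleO_of_lt {size : ℕ → ℕ} (hsize : ∀ n, 1 ≤ n → n < size n) :
    (fun n : ℕ => Real.log n) =o[atTop] fun n => (size n : ℝ) := by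
  have hle : (fun n : ℕ => (n : ℝ)) =O[atTop] fun n => (size n : ℝ) :=
    .of_bound' <| (eventually_ge_atTop 1).mono fun n hn => by
      simpa using (hsize n hn).le
  exact (Real.isLittleO_log_id_atTop.comp_tendsto tendsto_natCast_atTop_atTop).trans_isBigO hle

lemma natCast_isLittleO_of_mul_log_isLittleO_minSize {size : ℕ → ℕ → ℕ} {N : ℕ}
    (h : (fun n : ℕ => (n : ℝ) * Real.log n) =o[atTop] fun n => (minSize size N n : ℝ)) {k : ℕ}
    (hk : k ∈ Set.Icc 1 N) : (fun n : ℕ => (n : ℝ)) =o[atTop] fun n => (size k n : ℝ) := by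
  have hmin : (fun n => (minSize size N n : ℝ)) =O[atTop] fun n => (size k n : ℝ) :=
    .of_bound' <| .of_forall fun n => by
      simpa [minSize] using Nat.sInf_le (Set.mem_image_of_mem (fun k => size k n) hk)
  have hlog : (fun n : ℕ => (n : ℝ)) =O[atTop] fun n : ℕ => (n : ℝ) * Real.log n :=
    .of_bound' <| ((Real.tendsto_log_atTop.comp
      tendsto_natCast_atTop_atTop).eventually_ge_atTop 1).mono fun n hn => by
        rw [norm_mul]
        exact le_mul_of_one_le_right (norm_nonneg _) (hn.trans (Real.le_norm_self _))
  exact (hlog.trans_isLittleO h).trans_isBigO hmin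

end SampleSize

end RakingRatio

end

open RakingRatio in
theorem proposition3_general {Ω 𝒳 : Type*} [MeasurableSpace Ω] [MeasurableSpace 𝒳]
    (μ : Measure Ω) [IsProbabilityMeasure μ]
    (P P₀ : Measure 𝒳)
    (X : ℕ → Ω → 𝒳) (hX_indep : iIndepFun X μ) (hX_law : ∀ i, HasLaw (X i) P μ)
    (m : ℕ) (hm : 2 ≤ m) (B : Fin m → Set 𝒳) (hB : IsMeasurablePartition B)
    (hB_pos : ∀ i, 0 < P₀.real (B i))
    (N : ℕ) (mA : ℕ → ℕ) (A : (k : ℕ) → Fin (mA k) → Set 𝒳)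
    (hA : ∀ k ∈ Set.Icc 1 N, IsMeasurablePartition (A k))
    (hA_pos : ∀ k ∈ Set.Icc 1 N, ∀ j, 0 < P.real (A k j))
    (size : ℕ → ℕ → ℕ)
    (hsize : ∀ k ∈ Set.Icc 1 N, (fun n : ℕ => Real.log n) =o[atTop] fun n => (size k n : ℝ))
    (learned : (k : ℕ) → ℕ → Ω → Fin (mA k) → ℝ)
    (hlearned : ∀ k ∈ Set.Icc 1 N, ∀ n, 1 ≤ n →
      HasLaw (learned k n) (multinomialFreq (size k n) fun j => P.real (A k j)) μ) :
    ((∀ i, P.real (B i) = P₀.real (B i)) → ∀ α : ℝ, 0 < α → α < 1 →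
      (Tendsto (fun n => μ.real {ω | critical m α < stat B P₀ X n ω}) atTop (𝓝 α) ∧
        ∃ ℓ : ℝ,
          Tendsto (fun n => μ.real {ω | critical m α < statTrue B P₀ P A X N n ω})
            atTop (𝓝 ℓ) ∧
          ℓ ≤ α) ∧
      ((∀ k ∈ Set.Icc 1 N, (fun n : ℕ => (n : ℝ)) =o[atTop] fun n => (size k n : ℝ)) →
        ∃ ℓ : ℝ,
          Tendsto (fun n => μ.real {ω | critical m α < statLearned B P₀ A learned X N n ω})
            atTop (𝓝 ℓ) ∧
          ℓ ≤ α)) ∧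
    ((¬ ∀ i, P.real (B i) = P₀.real (B i)) → ∀ α : ℝ, 0 < α → α < 1 →
      ∀ᵐ ω ∂μ, ∃ n₀ : ℕ, ∀ n > n₀,
        critical m α <
          min |stat B P₀ X n ω|
            (min |statTrue B P₀ P A X N n ω| |statLearned B P₀ A learned X N n ω|)) := by
  have hP : IsProbabilityMeasure P := (hX_law 0).isProbabilityMeasure_iff.1 ‹_›
  have hlearned_meas (k) (hk : k ∈ Set.Icc 1 N) (j) (n) (hn : 1 ≤ n) :=
    (measurable_pi_apply j).comp_aemeasurable (hlearned k hk n hn).aemeasurable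
  have hsum (k) (hk : k ∈ Set.Icc 1 N) := (hA k hk).sum_measureReal (P := P)
  refine ⟨fun hH α hα0 hα1 => ?_, fun hH α _ _ => ?_⟩
  · have hPB (i) : 0 < P.real (B i) := hH i ▸ hB_pos i
    have hc := critical_pos hm hα0 hα1
    have hle := multivariateGaussian_iterCentered_cellScore_real_critical_lt_le
      hA hm hB hPB hα0 hα1
    refine ⟨⟨?_, _, ?_, hle⟩, fun hrate => ⟨_, ?_, hle⟩⟩
    · simpa only [multivariateGaussian_cellScore_real_critical_lt hm hB hPB hα0 hα1] using
        tendsto_measureReal_lt_stat hX_indep hX_law hB.measurableSet hH hc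
    · exact tendsto_measureReal_lt_chiStat_raked (w := fun k _ _ j => P.real (A k j)) hX_indep
        hX_law hA hA_pos (fun _ _ _ _ _ => aemeasurable_const)
        (fun _ _ _ => by simpa using tendsto_const_nhds) hB.measurableSet hH hc
    · exact tendsto_measureReal_lt_chiStat_raked hX_indep hX_law hA hA_pos hlearned_meas
        (fun k hk => tendsto_sqrt_mul_sub_of_hasLaw_multinomialFreq (fun _ => measureReal_nonneg)
          (hsum k hk) (hlearned k hk) (hrate k hk)) hB.measurableSet hH hc
  · obtain ⟨i, hi⟩ := not_forall.1 hH
    filter_upwards [ae_eventually_lt_abs_stat hX_indep hX_law hB.measurableSet hB_pos hi _,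
      ae_eventually_lt_abs_chiStat_raked (w := fun k _ _ j => P.real (A k j)) hX_indep hX_law hA
        hA_pos (fun _ _ _ => .of_forall fun _ => tendsto_const_nhds) hB.measurableSet hB_pos hi _,
      ae_eventually_lt_abs_chiStat_raked hX_indep hX_law hA hA_pos
        (fun k hk => ae_tendsto_of_hasLaw_multinomialFreq (fun _ => measureReal_nonneg)
          (hsum k hk) (hlearned k hk) (hsize k hk)) hB.measurableSet hB_pos hi _]
      with ω hstat htrue hlearned
    obtain ⟨n₀, hn₀⟩ := eventually_atTop.1 (hstat.and (htrue.and hlearned))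
    exact ⟨n₀, fun n hn => lt_min (hn₀ n hn.le).1 (lt_min (hn₀ n hn.le).2.1 (hn₀ n hn.le).2.2)⟩

open RakingRatio in
theorem proposition3 {Ω 𝒳 : Type*} [MeasurableSpace Ω] [MeasurableSpace 𝒳]
    (μ : Measure Ω) [IsProbabilityMeasure μ]
    (P P₀ : Measure 𝒳) [IsProbabilityMeasure P] [IsProbabilityMeasure P₀]
    -- the i.i.d. sample with law `P`
    (X : ℕ → Ω → 𝒳) (hX_indep : iIndepFun X μ) (hX_law : ∀ i, HasLaw (X i) P μ)
    -- the partition on which the test is performed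
    (m : ℕ) (hm : 2 ≤ m) (B : Fin m → Set 𝒳) (hB : IsMeasurablePartition B)
    (hB_pos : ∀ i, 0 < P₀.real (B i))
    -- the auxiliary partitions
    (N : ℕ) (mA : ℕ → ℕ) (A : (k : ℕ) → Fin (mA k) → Set 𝒳)
    (hA : ∀ k ∈ Set.Icc 1 N, IsMeasurablePartition (A k))
    (hA_pos : ∀ k ∈ Set.Icc 1 N, ∀ j, 0 < P.real (A k j))
    -- the sizes of the sources of information and the learned probabilities,
    -- with no assumption on their joint law with each other and with the sample
    (size : ℕ → ℕ → ℕ) (hsize : ∀ k ∈ Set.Icc 1 N, ∀ n, 1 ≤ n → n < size k n)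
    (learned : (k : ℕ) → ℕ → Ω → Fin (mA k) → ℝ)
    (hlearned : ∀ k ∈ Set.Icc 1 N, ∀ n, 1 ≤ n →
      HasLaw (learned k n) (multinomialFreq (size k n) fun j => P.real (A k j)) μ) :
    -- under the null hypothesis
    ((∀ i, P.real (B i) = P₀.real (B i)) → ∀ α : ℝ, 0 < α → α < 1 →
      (Tendsto (fun n => μ.real {ω | critical m α < stat B P₀ X n ω}) atTop (𝓝 α) ∧
        ∃ ℓ : ℝ,
          Tendsto (fun n => μ.real {ω | critical m α < statTrue B P₀ P A X N n ω})
            atTop (𝓝 ℓ) ∧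
          ℓ ≤ α) ∧
      ((fun n : ℕ => (n : ℝ) * Real.log n) =o[atTop] (fun n => (minSize size N n : ℝ)) →
        ∃ ℓ : ℝ,
          Tendsto (fun n => μ.real {ω | critical m α < statLearned B P₀ A learned X N n ω})
            atTop (𝓝 ℓ) ∧
          ℓ ≤ α)) ∧
    -- under the alternative hypothesis
    ((¬ ∀ i, P.real (B i) = P₀.real (B i)) → ∀ α : ℝ, 0 < α → α < 1 →
      ∀ᵐ ω ∂μ, ∃ n₀ : ℕ, ∀ n > n₀,
        critical m α <
          min |stat B P₀ X n ω|
            (min |statTrue B P₀ P A X N n ω| |statLearned B P₀ A learned X N n ω|)) := by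
  have hgeneral := proposition3_general μ P P₀ X hX_indep hX_law m hm B hB hB_pos N mA A hA hA_pos
    size (fun k hk => log_isLittleO_of_lt (hsize k hk)) learned hlearned
  exact ⟨fun hH α hα0 hα1 => (hgeneral.1 hH α hα0 hα1).imp_right fun hlimit hrate =>
    hlimit fun _ hk => natCast_isLittleO_of_mul_log_isLittleO_minSize hrate hk, hgeneral.2⟩
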